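/- Let $N\ge 2$ be an integer and let $1\le p\le N$ be real. Write $B_r(x_0)$ for the open ball of radius $r$ centred at $x_0$ in $\mathbb{R}^N$, and $C^\infty_0(E)$ for the smooth functions whose support is a compact subset of the open set $E\subseteq\mathbb{R}^N$. For an open set $\Omega\subseteq\mathbb{R}^N$ put \[ \lambda_p(\Omega)=\inf\left\{\int_\Omega|\nabla\varphi|^p\,dx\,:\,\varphi\in C^\infty_0(\Omega),\ \|\varphi\|_{L^p(\Omega)}=1\right\}\in[0,+\infty], \] and for an open set $E$ and a compact set $\Sigma\subseteq E$ put \[ \mathrm{cap}_p(\Sigma;E)=\inf\left\{\int_E|\nabla\varphi|^p\,dx\,:\,\varphi\in C^\infty_0(E),\ \varphi\ge 1\text{ on }\Sigma\right\}. \] For $0<\gamma<1$ the capacitary inradius $R_{p,\gamma}(\Omega)\in[0,+\infty]$ is the supremum of all $r>0$ for which there is $x_0\in\mathbb{R}^N$ with \[ \mathrm{cap}_p\left(\overline{B_r(x_0)}\setminus\Omega;B_{2r}(x_0)\right)\le\gamma\,\mathrm{cap}_p\left(\overline{B_r(x_0)};B_{2r}(x_0)\right). \] Here $\inf\emptyset=+\infty$,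 $\sup\emptyset=0$, $1/0=+\infty$ and $1/(+\infty)=0$. Then there are a constant $\sigma_{N,p}>0$, depending only on $N$ and $p$, and constants $C_{N,p,\gamma}$, depending only on $N$, $p$ and $\gamma$, with $C_{N,p,\gamma}\to+\infty$ as $\gamma\nearrow 1$, such that for every $0<\gamma<1$ and every open set $\Omega\subseteq\mathbb{R}^N$ \[ \sigma_{N,p}\,\gamma\left(\frac{1}{R_{p,\gamma}(\Omega)}\right)^p\le\lambda_p(\Omega)\le C_{N,p,\gamma}\left(\frac{1}{R_{p,\gamma}(\Omega)}\right)^p . \] The divergence cannot be avoided: if $(C_\gamma)_{0<\gamma<1}$ are real constants such that $\lambda_p(\Omega)\le C_\gamma\,R_{p,\gamma}(\Omega)^{-p}$ for every $0<\gamma<1$ and every open $\Omega\subseteq\mathbb{R}^N$, then $C_\gamma\to+\infty$ as $\gamma\nearrow1$. In particular, for every open $\Omega\subseteq\mathbb{R}^N$ and every $0<\gamma<1$, \[ \lambda_p(\Omega)>0\quad\Longleftrightarrow\quad R_{p,\gamma}(\Omega)<+\infty, \] and the condition $R_{p,\gamma}(\Omega)<+\infty$ does not depend on $\gamma\in(0,1)$: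 if it holds for one $\gamma$, it holds for all. -/

import Mathlib

open MeasureTheory Metric Set Filter Topology
open scoped ENNReal ContDiff

namespace CapInradius

/-- `φ ∈ C^∞_0(E)`: `φ` is smooth on the whole space and its support is a compact subset of `E`. -/
def IsTest {N : ℕ} (E : Set (EuclideanSpace ℝ (Fin N)))
    (φ : EuclideanSpace ℝ (Fin N) → ℝ) : Prop :=
  ContDiff ℝ ∞ φ ∧ HasCompactSupport φ ∧ tsupport φ ⊆ E

/-- The Dirichlet integral `∫_E |∇φ|^p dx`. -/
noncomputable def dirichlet {N : ℕ} (p : ℝ) (E : Set (EuclideanSpace ℝ (Fin N)))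
    (φ : EuclideanSpace ℝ (Fin N) → ℝ) : ℝ≥0∞ :=
  ∫⁻ x in E, ‖gradient φ x‖ₑ ^ p

/-- The sharp `L^p` Poincaré constant
`λ_p(Ω) = inf {∫_Ω |∇φ|^p dx : φ ∈ C^∞_0(Ω), ‖φ‖_{L^p(Ω)} = 1}`
(so that it is `+∞` for `Ω = ∅`). -/
noncomputable def poincareConst {N : ℕ} (p : ℝ) (Ω : Set (EuclideanSpace ℝ (Fin N))) : ℝ≥0∞ :=
  ⨅ (φ : EuclideanSpace ℝ (Fin N) → ℝ)
    (_ : IsTest Ω φ ∧ eLpNorm φ (ENNReal.ofReal p) (volume.restrict Ω) = 1), dirichlet p Ω φ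

/-- The `p`-capacity of a compact set `K` relative to the open set `E ⊇ K`:
`cap_p(K; E) = inf {∫_E |∇φ|^p dx : φ ∈ C^∞_0(E), φ ≥ 1 on K}`. -/
noncomputable def relCap {N : ℕ} (p : ℝ) (K E : Set (EuclideanSpace ℝ (Fin N))) : ℝ≥0∞ :=
  ⨅ (φ : EuclideanSpace ℝ (Fin N) → ℝ)
    (_ : IsTest E φ ∧ ∀ x ∈ K, 1 ≤ φ x), dirichlet p E φ

/-- A compact set `K` contained in the closed ball of radius `r` centred at `x₀` is
`(p, γ)`-negligible if its capacity relative to the concentric open ball of radius `2r` is at most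
`γ` times that of the closed ball. -/
def IsNegligible {N : ℕ} (p γ : ℝ) (x₀ : EuclideanSpace ℝ (Fin N)) (r : ℝ)
    (K : Set (EuclideanSpace ℝ (Fin N))) : Prop :=
  relCap p K (ball x₀ (2 * r)) ≤
    ENNReal.ofReal γ * relCap p (closedBall x₀ r) (ball x₀ (2 * r))

/-- The capacitary inradius `R_{p,γ}(Ω)`, an extended number in `[0, +∞]`
(the supremum of the empty set is `0`). -/
noncomputable def capInradius {N : ℕ} (p γ : ℝ) (Ω : Set (EuclideanSpace ℝ (Fin N))) : ℝ≥0∞ :=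
  ⨆ (r : ℝ) (_ : 0 < r ∧ ∃ x₀ : EuclideanSpace ℝ (Fin N),
    IsNegligible p γ x₀ r (closedBall x₀ r \ Ω)), ENNReal.ofReal r

end CapInradius

/-!
All quantities scale, so radius one suffices.

*Lower bound.* By Maz'ya's inequality a function vanishing on `K ⊆ closedBall y 1` satisfies a
Poincaré inequality on `ball y 2` with constant of order `1 / relCap p K (ball y 2)`. If no ball
of radius one is negligible, this applies on every unit ball with `K = closedBall y 1 \ Ω`, and
averaging over `y` gives a lower bound of order `γ` for the Poincaré constant.

*Upper bound.* If `closedBall y 1 \ Ω` has capacity below `γ` times that of the ball, let `u` be a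
nearly optimal competitor for it, equal to one near it. Then `1 - u` times a cutoff function is
admissible for the Poincaré constant. It cannot be small in `L^p`: adding `(1 - u)` times a cutoff
function to `u` gives a competitor for the capacity of a slightly smaller ball, which by continuity
in the radius still exceeds `γ` times the capacity of the full ball.

*Blow-up.* Thin neighbourhoods of the unit sphere have arbitrarily large Poincaré constant, while
what they leave of the unit ball lies in a smaller ball, whose capacity is strictly smaller. Hence
that remainder is negligible for `γ` close to one, and the capacitary inradius is at least one.
-/

namespace CapInradius

section LocalPoincare

variable {X F : Type*} [NormedAddCommGroup X] [NormedSpace ℝ X] [NormedAddCommGroup F]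
  [NormedSpace ℝ F] {p : ℝ} {u : X → F} {s : Set X}

theorem enorm_sub_rpow_le_mul_lintegral_lineMap (hp : 1 ≤ p) (hu : ContDiff ℝ 1 u) (x y : X) :
    ‖u x - u y‖ₑ ^ p ≤
      ‖x - y‖ₑ ^ p * ∫⁻ t in Icc (0 : ℝ) 1, ‖fderiv ℝ u (AffineMap.lineMap y x t)‖ₑ ^ p := by
  have hp0 : 0 < p := by linarith
  have hderiv (t : ℝ) : ‖deriv (fun t : ℝ => u (AffineMap.lineMap y x t)) t‖ₑ ≤
      ‖x - y‖ₑ * ‖fderiv ℝ u (AffineMap.lineMap y x t)‖ₑ := by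
    have h := (hu.differentiable one_ne_zero (AffineMap.lineMap y x t)).hasFDerivAt.comp_hasDerivAt
      t AffineMap.hasDerivAt_lineMap
    rw [show deriv (fun t : ℝ => u (AffineMap.lineMap y x t)) t = _ from h.deriv, mul_comm]
    exact ContinuousLinearMap.le_opENorm _ _
  have hftc : ‖u x - u y‖ₑ ≤
      ‖x - y‖ₑ * ∫⁻ t in Icc (0 : ℝ) 1, ‖fderiv ℝ u (AffineMap.lineMap y x t)‖ₑ := by
    have h := enorm_sub_le_lintegral_deriv_of_contDiffOn_Icc
      (f := fun t : ℝ => u (AffineMap.lineMap y x t)) (a := 0) (b := 1)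
      (hu.comp (AffineMap.contDiff_lineMap y x)).contDiffOn zero_le_one
    simp only [AffineMap.lineMap_apply_one, AffineMap.lineMap_apply_zero] at h
    rw [← lintegral_const_mul' _ _ enorm_ne_top]
    exact h.trans (lintegral_mono hderiv)
  have hprob : IsProbabilityMeasure (volume.restrict (Icc (0 : ℝ) 1)) := ⟨by simp⟩
  have hjensen := eLpNorm'_le_eLpNorm'_of_exponent_le one_pos hp (volume.restrict (Icc (0 : ℝ) 1))
    ((hu.continuous_fderiv one_ne_zero).comp
      (AffineMap.lineMap_continuous (p := y) (q := x))).aestronglyMeasurable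
  simp only [eLpNorm', ENNReal.rpow_one, div_one, one_div, Function.comp_apply] at hjensen
  calc ‖u x - u y‖ₑ ^ p
      ≤ (‖x - y‖ₑ * ∫⁻ t in Icc (0 : ℝ) 1, ‖fderiv ℝ u (AffineMap.lineMap y x t)‖ₑ) ^ p := by
        gcongr
    _ = ‖x - y‖ₑ ^ p * (∫⁻ t in Icc (0 : ℝ) 1, ‖fderiv ℝ u (AffineMap.lineMap y x t)‖ₑ) ^ p :=
        ENNReal.mul_rpow_of_nonneg _ _ hp0.le
    _ ≤ _ := by
        gcongr
        exact (ENNReal.le_rpow_inv_iff hp0).1 hjensen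

variable [MeasurableSpace X] [BorelSpace X] [FiniteDimensional ℝ X] (μ : Measure X)
  [μ.IsAddHaarMeasure]

open Module (finrank)

theorem lintegral_comp_add_smul (f : X → ℝ≥0∞) (a : X) {r : ℝ} (hr : 0 < r) :
    ∫⁻ x, f (a + r • x) ∂μ = (ENNReal.ofReal r ^ finrank ℝ X)⁻¹ * ∫⁻ x, f x ∂μ := by
  have h : ∫⁻ x, f (a + r • x) ∂μ = ∫⁻ y, f (a + y) ∂(μ.map (r • ·)) :=
    ((Homeomorph.smulOfNeZero r hr.ne').measurableEmbedding.lintegral_map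
      (fun y => f (a + y))).symm
  rw [h, Measure.map_addHaar_smul _ hr.ne', lintegral_smul_measure,
    lintegral_add_left_eq_self f a, smul_eq_mul, abs_of_pos (by positivity),
    ENNReal.ofReal_inv_of_pos (by positivity), ENNReal.ofReal_pow hr.le]

theorem setLIntegral_comp_lineMap_le (hs : MeasurableSet s) (hconv : Convex ℝ s)
    (g : X → ℝ≥0∞) {z : X} (hz : z ∈ s) {t : ℝ} (ht : t ∈ Icc (1 / 2) 1) :
    ∫⁻ y in s, g (AffineMap.lineMap z y t) ∂μ ≤ 2 ^ finrank ℝ X * ∫⁻ y in s, g y ∂μ := by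
  have ht0 : 0 < t := by linarith [ht.1]
  have hline (y : X) : AffineMap.lineMap z y t = (z - t • z) + t • y := by
    rw [AffineMap.lineMap_apply_module']
    module
  calc ∫⁻ y in s, g (AffineMap.lineMap z y t) ∂μ
      ≤ ∫⁻ y in s, s.indicator g (AffineMap.lineMap z y t) ∂μ := by
        refine setLIntegral_mono' hs fun y hy => ?_
        rw [indicator_of_mem (hconv.lineMap_mem hz hy ⟨ht0.le, ht.2⟩)]
    _ ≤ ∫⁻ y, s.indicator g (AffineMap.lineMap z y t) ∂μ := setLIntegral_le_lintegral _ _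
    _ = (ENNReal.ofReal t ^ finrank ℝ X)⁻¹ * ∫⁻ y in s, g y ∂μ := by
        simp_rw [hline]
        rw [lintegral_comp_add_smul μ _ _ ht0, lintegral_indicator hs]
    _ ≤ 2 ^ finrank ℝ X * ∫⁻ y in s, g y ∂μ := by
        rw [ENNReal.inv_pow, ← ENNReal.ofReal_inv_of_pos ht0]
        gcongr
        rw [← ENNReal.ofReal_ofNat 2]
        exact ENNReal.ofReal_le_ofReal ((inv_le_comm₀ ht0 two_pos).2 (by linarith [ht.1]))

/- One endpoint of the segment from `y` to `x` carries weight at least `1 / 2` at time `t`, and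
integrating in that variable first costs only a factor `2 ^ dim X`. -/
theorem setLIntegral_setLIntegral_comp_lineMap_le (hs : MeasurableSet s) (hconv : Convex ℝ s)
    {g : X → ℝ≥0∞} (hg : Measurable g) {t : ℝ} (ht : t ∈ Icc (0 : ℝ) 1) :
    ∫⁻ x in s, ∫⁻ y in s, g (AffineMap.lineMap y x t) ∂μ ∂μ ≤
      2 ^ finrank ℝ X * μ s * ∫⁻ x in s, g x ∂μ := by
  have hconst : ∫⁻ _ in s, (2 ^ finrank ℝ X * ∫⁻ x in s, g x ∂μ) ∂μ =
      2 ^ finrank ℝ X * μ s * ∫⁻ x in s, g x ∂μ := by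
    rw [setLIntegral_const, mul_right_comm]
  rw [← hconst]
  rcases le_total (1 / 2) t with h | h
  · rw [lintegral_lintegral_swap]
    · exact setLIntegral_mono' hs fun y hy =>
        setLIntegral_comp_lineMap_le μ hs hconv g hy ⟨h, ht.2⟩
    · refine (hg.comp ?_).aemeasurable
      simp only [AffineMap.lineMap_apply_module']
      fun_prop
  · refine setLIntegral_mono' hs fun x hx => ?_
    simp_rw [← AffineMap.lineMap_apply_one_sub x _ t]
    exact setLIntegral_comp_lineMap_le μ hs hconv g hx ⟨by linarith, by linarith [ht.1]⟩

theorem setLIntegral_setLIntegral_enorm_sub_rpow_le (hp : 1 ≤ p) (hu : ContDiff ℝ 1 u)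
    (hs : MeasurableSet s) (hconv : Convex ℝ s) (hbdd : Bornology.IsBounded s) :
    ∫⁻ x in s, ∫⁻ y in s, ‖u x - u y‖ₑ ^ p ∂μ ∂μ ≤
      ediam s ^ p * 2 ^ finrank ℝ X * μ s * ∫⁻ x in s, ‖fderiv ℝ u x‖ₑ ^ p ∂μ := by
  set g : X → ℝ≥0∞ := fun x => ‖fderiv ℝ u x‖ₑ ^ p
  have hg : Continuous g := by fun_prop (disch := simp)
  have hd : ediam s ^ p ≠ ⊤ := ENNReal.rpow_ne_top_of_nonneg (by linarith) hbdd.ediam_ne_top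
  have hmeas : Measurable fun q : (ℝ × X) × X => g (AffineMap.lineMap q.2 q.1.2 q.1.1) := by
    refine hg.measurable.comp ?_
    simp only [AffineMap.lineMap_apply_module']
    fun_prop
  calc ∫⁻ x in s, ∫⁻ y in s, ‖u x - u y‖ₑ ^ p ∂μ ∂μ
      ≤ ∫⁻ x in s, ∫⁻ y in s, ediam s ^ p *
          (∫⁻ t in Icc (0 : ℝ) 1, g (AffineMap.lineMap y x t)) ∂μ ∂μ := by
        refine setLIntegral_mono' hs fun x hx => setLIntegral_mono' hs fun y hy => ?_
        refine (enorm_sub_rpow_le_mul_lintegral_lineMap hp hu x y).trans ?_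
        gcongr
        rw [← edist_eq_enorm_sub]
        exact edist_le_ediam_of_mem hx hy
    _ = ediam s ^ p * ∫⁻ t in Icc (0 : ℝ) 1,
          ∫⁻ x in s, ∫⁻ y in s, g (AffineMap.lineMap y x t) ∂μ ∂μ := by
        simp_rw [lintegral_const_mul' _ _ hd]
        rw [lintegral_lintegral_swap
          (f := fun t x => ∫⁻ y in s, g (AffineMap.lineMap y x t) ∂μ)
          hmeas.lintegral_prod_right'.aemeasurable]
        congr 1
        refine lintegral_congr fun x => lintegral_lintegral_swap ?_
        exact (hmeas.comp (by fun_prop : Measurable fun q : X × ℝ => ((q.2, x), q.1))).aemeasurable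
    _ ≤ ediam s ^ p * ∫⁻ _ in Icc (0 : ℝ) 1, 2 ^ finrank ℝ X * μ s * ∫⁻ x in s, g x ∂μ := by
        gcongr ediam s ^ p * ?_
        exact setLIntegral_mono' measurableSet_Icc fun t ht =>
          setLIntegral_setLIntegral_comp_lineMap_le μ hs hconv hg.measurable ht
    _ = _ := by
        rw [setLIntegral_const, Real.volume_Icc, sub_zero, ENNReal.ofReal_one, mul_one]
        ring

theorem measure_inter_zeros_mul_setLIntegral_le (hp : 1 ≤ p) (hu : ContDiff ℝ 1 u)
    (hs : MeasurableSet s) (hconv : Convex ℝ s) (hbdd : Bornology.IsBounded s) :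
    μ (s ∩ {x | u x = 0}) * ∫⁻ x in s, ‖u x‖ₑ ^ p ∂μ ≤
      ediam s ^ p * 2 ^ finrank ℝ X * μ s * ∫⁻ x in s, ‖fderiv ℝ u x‖ₑ ^ p ∂μ := by
  have hzeros : MeasurableSet (s ∩ {x | u x = 0}) :=
    hs.inter (isClosed_singleton.preimage hu.continuous).measurableSet
  refine le_trans ?_ (setLIntegral_setLIntegral_enorm_sub_rpow_le μ hp hu hs hconv hbdd)
  rw [← lintegral_const_mul _ (hu.continuous.enorm.measurable.pow_const p)]
  refine lintegral_mono fun x => ?_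
  calc μ (s ∩ {x | u x = 0}) * ‖u x‖ₑ ^ p
      = ∫⁻ y in s ∩ {x | u x = 0}, ‖u x - u y‖ₑ ^ p ∂μ := by
        rw [mul_comm, ← setLIntegral_const]
        refine setLIntegral_congr_fun hzeros fun y hy => ?_
        simp only [show u y = 0 from hy.2, sub_zero]
    _ ≤ ∫⁻ y in s, ‖u x - u y‖ₑ ^ p ∂μ := lintegral_mono_set inter_subset_left

theorem exists_setLIntegral_enorm_sub_rpow_le (hp : 1 ≤ p) (hu : ContDiff ℝ 1 u)
    (hs : MeasurableSet s) (hconv : Convex ℝ s) (hbdd : Bornology.IsBounded s) (h0 : μ s ≠ 0) :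
    ∃ z ∈ s, ∫⁻ x in s, ‖u x - u z‖ₑ ^ p ∂μ ≤
      ediam s ^ p * 2 ^ finrank ℝ X * ∫⁻ x in s, ‖fderiv ℝ u x‖ₑ ^ p ∂μ := by
  have hpair : Continuous fun q : X × X => ‖u q.2 - u q.1‖ₑ ^ p := by
    have := hu.continuous
    fun_prop
  have hmeas : Measurable fun z => ∫⁻ x in s, ‖u x - u z‖ₑ ^ p ∂μ :=
    hpair.measurable.lintegral_prod_right'
  have htop : μ s ≠ ⊤ := hbdd.measure_lt_top.ne
  obtain ⟨z, hz, h⟩ := exists_le_setLAverage h0 htop hmeas.aemeasurable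
  refine ⟨z, hz, h.trans ?_⟩
  rw [setLAverage_eq]
  refine ENNReal.div_le_of_le_mul ?_
  simp_rw [enorm_sub_rev]
  refine (setLIntegral_setLIntegral_enorm_sub_rpow_le μ hp hu hs hconv hbdd).trans_eq ?_
  ring

theorem lintegral_setLIntegral_ball {f : X → ℝ≥0∞} (hf : Measurable f) (r : ℝ) :
    ∫⁻ y, ∫⁻ x in ball y r, f x ∂μ ∂μ = μ (ball 0 r) * ∫⁻ x, f x ∂μ := by
  have hind (y : X) :
      ∫⁻ x in ball y r, f x ∂μ = ∫⁻ x, (ball x r).indicator (fun _ => f x) y ∂μ := by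
    rw [← lintegral_indicator measurableSet_ball]
    simp only [indicator, mem_ball, dist_comm _ y]
  have hmeas : Measurable fun q : X × X => (ball q.2 r).indicator (fun _ => f q.2) q.1 :=
    (hf.comp measurable_snd).indicator (measurableSet_lt measurable_dist measurable_const)
  simp_rw [hind]
  rw [lintegral_lintegral_swap hmeas.aemeasurable]
  simp_rw [lintegral_indicator measurableSet_ball, setLIntegral_const, Measure.addHaar_ball_center]
  rw [lintegral_mul_const _ hf, mul_comm]

end LocalPoincare

variable {N : ℕ} {p : ℝ} {φ ψ : EuclideanSpace ℝ (Fin N) → ℝ}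
  {K K' E E' Ω : Set (EuclideanSpace ℝ (Fin N))} {b : ℝ≥0∞}

/-- The `p`-energy of `φ`, integrated over the whole space. For test functions it is the Dirichlet
integral, without reference to the open set that contains the support. -/
noncomputable def energy (p : ℝ) (φ : EuclideanSpace ℝ (Fin N) → ℝ) : ℝ≥0∞ :=
  ∫⁻ x, ‖fderiv ℝ φ x‖ₑ ^ p

theorem setLIntegral_fderiv_eq_energy (hp : 0 < p) (h : tsupport φ ⊆ E) :
    ∫⁻ x in E, ‖fderiv ℝ φ x‖ₑ ^ p = energy p φ := by
  refine setLIntegral_eq_of_support_subset fun x hx => h (support_fderiv_subset ℝ fun h0 => hx ?_)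
  simp [← ofReal_norm, h0, hp]

theorem energy_const_mul (hp : 0 ≤ p) (h : Differentiable ℝ φ) (a : ℝ) :
    energy p (fun x => a * φ x) = ‖a‖ₑ ^ p * energy p φ := by
  unfold energy
  rw [← lintegral_const_mul' _ _ (ENNReal.rpow_ne_top_of_nonneg hp enorm_ne_top)]
  refine lintegral_congr fun x => ?_
  rw [fderiv_const_mul (h x), enorm_smul, ENNReal.mul_rpow_of_nonneg _ _ hp]

namespace IsTest

theorem dirichlet_eq (hp : 0 < p) (h : IsTest E φ) : dirichlet p E φ = energy p φ := by
  rw [dirichlet, ← setLIntegral_fderiv_eq_energy hp h.2.2]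
  simp_rw [gradient, LinearIsometryEquiv.enorm_map]

theorem contDiff_one (h : IsTest E φ) : ContDiff ℝ 1 φ :=
  h.1.of_le (by exact_mod_cast le_top)

theorem differentiable (h : IsTest E φ) : Differentiable ℝ φ :=
  h.contDiff_one.differentiable one_ne_zero

theorem eq_zero_of_notMem (h : IsTest E φ) {x : EuclideanSpace ℝ (Fin N)} (hx : x ∉ E) :
    φ x = 0 :=
  image_eq_zero_of_notMem_tsupport fun hx' => hx (h.2.2 hx')

theorem mono (h : IsTest E φ) (hE : E ⊆ E') : IsTest E' φ :=
  ⟨h.1, h.2.1, h.2.2.trans hE⟩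

theorem const_mul (h : IsTest E φ) (a : ℝ) : IsTest E (fun x => a * φ x) :=
  ⟨contDiff_const.mul h.1, h.2.1.mul_left, tsupport_mul_subset_right.trans h.2.2⟩

theorem add (hφ : IsTest E φ) (hψ : IsTest E ψ) : IsTest E (fun x => φ x + ψ x) :=
  ⟨hφ.1.add hψ.1, hφ.2.1.add hψ.2.1, (tsupport_add φ ψ).trans (union_subset hφ.2.2 hψ.2.2)⟩

theorem mul_contDiff (h : IsTest E φ) (hψ : ContDiff ℝ ∞ ψ) : IsTest E (fun x => φ x * ψ x) :=
  ⟨h.1.mul hψ, h.2.1.mul_right, tsupport_mul_subset_left.trans h.2.2⟩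

theorem lintegral_enorm_rpow_lt_top (hp : 0 < p) (h : IsTest E φ) :
    ∫⁻ x, ‖φ x‖ₑ ^ p < ⊤ := by
  have hLp : MemLp φ (ENNReal.ofReal p) volume := h.1.continuous.memLp_of_hasCompactSupport h.2.1
  have := lintegral_rpow_enorm_lt_top_of_eLpNorm_lt_top (by simpa using hp)
    ENNReal.ofReal_ne_top hLp.2
  rwa [ENNReal.toReal_ofReal hp.le] at this

theorem eLpNorm_eq_one_iff (hp : 0 < p) (h : IsTest E φ) :
    eLpNorm φ (ENNReal.ofReal p) (volume.restrict E) = 1 ↔ ∫⁻ x, ‖φ x‖ₑ ^ p = 1 := by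
  rw [eLpNorm_eq_lintegral_rpow_enorm_toReal (by simpa using hp) ENNReal.ofReal_ne_top,
    ENNReal.toReal_ofReal hp.le, setLIntegral_eq_of_support_subset]
  · constructor <;> intro h1
    · rw [← ENNReal.rpow_inv_rpow hp.ne' (∫⁻ x, ‖φ x‖ₑ ^ p), ← one_div, h1, ENNReal.one_rpow]
    · rw [h1, ENNReal.one_rpow]
  · intro x hx
    by_contra hxE
    simp [h.eq_zero_of_notMem hxE, hp] at hx

end IsTest

theorem poincareConst_mul_le (hp : 0 < p) (h : IsTest Ω φ) :
    poincareConst p Ω * ∫⁻ x, ‖φ x‖ₑ ^ p ≤ energy p φ := by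
  set I := ∫⁻ x, ‖φ x‖ₑ ^ p
  have hItop : I ≠ ⊤ := (h.lintegral_enorm_rpow_lt_top hp).ne
  rcases eq_or_ne I 0 with h0 | h0
  · simp [h0]
  obtain ⟨a, ha⟩ : ∃ a : ℝ, ‖a‖ₑ ^ p = I⁻¹ := by
    refine ⟨(I ^ (-p⁻¹)).toReal, ?_⟩
    rw [Real.enorm_eq_ofReal ENNReal.toReal_nonneg,
      ENNReal.ofReal_toReal (ENNReal.rpow_ne_top_of_ne_zero h0 hItop), ← ENNReal.rpow_mul,
      neg_mul, inv_mul_cancel₀ hp.ne', ENNReal.rpow_neg_one]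
  have hnorm : ∫⁻ x, ‖a * φ x‖ₑ ^ p = 1 := by
    simp_rw [enorm_mul, ENNReal.mul_rpow_of_nonneg _ _ hp.le, ha]
    rw [lintegral_const_mul' _ _ (ENNReal.inv_ne_top.2 h0), ENNReal.inv_mul_cancel h0 hItop]
  have hle : poincareConst p Ω ≤ I⁻¹ * energy p φ := by
    have ht := h.const_mul a
    rw [← ha, ← energy_const_mul hp.le h.differentiable, ← ht.dirichlet_eq hp]
    exact iInf₂_le _ ⟨ht, (ht.eLpNorm_eq_one_iff hp).2 hnorm⟩
  rwa [mul_comm, ENNReal.mul_le_iff_le_inv h0 hItop]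

theorem le_poincareConst (hp : 0 < p)
    (h : ∀ φ, IsTest Ω φ → b * ∫⁻ x, ‖φ x‖ₑ ^ p ≤ energy p φ) : b ≤ poincareConst p Ω := by
  refine le_iInf₂ fun φ ⟨hφ, hnorm⟩ => ?_
  simpa only [(hφ.eLpNorm_eq_one_iff hp).1 hnorm, mul_one, hφ.dirichlet_eq hp] using h φ hφ

theorem relCap_le (hp : 0 < p) (h : IsTest E φ) (hK : ∀ x ∈ K, 1 ≤ φ x) :
    relCap p K E ≤ energy p φ :=
  (iInf₂_le φ ⟨h, hK⟩).trans_eq (h.dirichlet_eq hp)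

theorem le_relCap (hp : 0 < p)
    (h : ∀ φ, IsTest E φ → (∀ x ∈ K, 1 ≤ φ x) → b ≤ energy p φ) : b ≤ relCap p K E :=
  le_iInf₂ fun φ hφ => (h φ hφ.1 hφ.2).trans_eq (hφ.1.dirichlet_eq hp).symm

theorem exists_energy_lt_of_relCap_lt (hp : 0 < p) (h : relCap p K E < b) :
    ∃ φ, IsTest E φ ∧ (∀ x ∈ K, 1 ≤ φ x) ∧ energy p φ < b := by
  by_contra! hc
  exact h.not_ge (le_relCap hp hc)

theorem relCap_mono (hp : 0 < p) (hK : K ⊆ K') (hE : E' ⊆ E) : relCap p K E ≤ relCap p K' E' :=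
  le_relCap hp fun _ hφ h1 => relCap_le hp (hφ.mono hE) fun x hx => h1 x (hK hx)

theorem relCap_mul_enorm_rpow_le (hp : 0 < p) (h : IsTest E φ) {m : ℝ} (hK : ∀ x ∈ K, φ x = m) :
    relCap p K E * ‖m‖ₑ ^ p ≤ energy p φ := by
  rcases eq_or_ne m 0 with rfl | hm
  · simp [hp]
  have hle : relCap p K E ≤ energy p (fun x => m⁻¹ * φ x) :=
    relCap_le hp (h.const_mul m⁻¹) fun x hx => by rw [hK x hx, inv_mul_cancel₀ hm]
  rwa [energy_const_mul hp.le h.differentiable, enorm_inv hm, ENNReal.inv_rpow,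
    ← ENNReal.mul_le_iff_le_inv (by simp [hm]) (by simp [hp.le]), mul_comm] at hle

/-! ### Scaling -/

section Scaling

theorem ofReal_le_capInradius {γ r : ℝ} (hr : 0 < r) {y : EuclideanSpace ℝ (Fin N)}
    (h : IsNegligible p γ y r (closedBall y r \ Ω)) : ENNReal.ofReal r ≤ capInradius p γ Ω :=
  le_iSup₂_of_le r ⟨hr, y, h⟩ le_rfl

theorem ofReal_rpow_sub_natCast {r : ℝ} (hr : 0 < r) (q : ℝ) (n : ℕ) :
    ENNReal.ofReal r ^ (q - n) = ENNReal.ofReal r ^ q * (ENNReal.ofReal r ^ n)⁻¹ := by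
  rw [ENNReal.rpow_sub _ _ (by simpa using hr) ENNReal.ofReal_ne_top, ENNReal.rpow_natCast,
    div_eq_mul_inv]

theorem ofReal_rpow_ne_zero {r : ℝ} (hr : 0 < r) (q : ℝ) : ENNReal.ofReal r ^ q ≠ 0 :=
  (ENNReal.rpow_pos (ENNReal.ofReal_pos.2 hr) ENNReal.ofReal_ne_top).ne'

theorem ofReal_rpow_ne_top {r : ℝ} (hr : 0 < r) (q : ℝ) : ENNReal.ofReal r ^ q ≠ ⊤ :=
  ENNReal.rpow_ne_top_of_ne_zero (ENNReal.ofReal_pos.2 hr).ne' ENNReal.ofReal_ne_top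

variable (a : EuclideanSpace ℝ (Fin N)) {r : ℝ} (hr : 0 < r)
include hr

theorem IsTest.comp_add_smul (h : IsTest E φ) :
    IsTest ((fun x => a + r • x) ⁻¹' E) (fun x => φ (a + r • x)) := by
  let T := (Homeomorph.smulOfNeZero r hr.ne').trans (Homeomorph.addLeft a)
  exact ⟨h.1.comp (by fun_prop), h.2.1.comp_homeomorph T,
    (tsupport_comp_subset_preimage φ T.continuous).trans (preimage_mono h.2.2)⟩

theorem energy_comp_add_smul (hp : 0 ≤ p) (φ : EuclideanSpace ℝ (Fin N) → ℝ) :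
    energy p (fun x => φ (a + r • x)) = ENNReal.ofReal r ^ (p - N) * energy p φ := by
  have hderiv (x : EuclideanSpace ℝ (Fin N)) :
      fderiv ℝ (fun x => φ (a + r • x)) x = r • fderiv ℝ φ (a + r • x) := by
    rw [fderiv_comp_smul (f := fun y => φ (a + y)), fderiv_comp_add_left]
  simp_rw [energy, hderiv, enorm_smul, ENNReal.mul_rpow_of_nonneg _ _ hp,
    Real.enorm_eq_ofReal hr.le]
  rw [lintegral_const_mul' _ _ (ofReal_rpow_ne_top hr p),
    lintegral_comp_add_smul volume (fun x => ‖fderiv ℝ φ x‖ₑ ^ p) a hr,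
    finrank_euclideanSpace_fin, ofReal_rpow_sub_natCast hr, mul_assoc]

theorem preimage_add_smul_preimage_inv (E : Set (EuclideanSpace ℝ (Fin N))) :
    (fun x => -(r⁻¹ • a) + r⁻¹ • x) ⁻¹' ((fun x => a + r • x) ⁻¹' E) = E := by
  ext x
  simp [smul_smul, hr.ne']

theorem relCap_preimage_add_smul_le (hp : 0 < p) (K E : Set (EuclideanSpace ℝ (Fin N))) :
    relCap p ((fun x => a + r • x) ⁻¹' K) ((fun x => a + r • x) ⁻¹' E) ≤
      ENNReal.ofReal r ^ (p - N) * relCap p K E := by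
  rw [← ENNReal.inv_mul_le_iff (ofReal_rpow_ne_zero hr _) (ofReal_rpow_ne_top hr _)]
  refine le_relCap hp fun φ hφ hK => ?_
  rw [ENNReal.inv_mul_le_iff (ofReal_rpow_ne_zero hr _) (ofReal_rpow_ne_top hr _),
    ← energy_comp_add_smul a hr hp.le φ]
  exact relCap_le hp (hφ.comp_add_smul a hr) fun x hx => hK _ hx

theorem relCap_preimage_add_smul (hp : 0 < p) (K E : Set (EuclideanSpace ℝ (Fin N))) :
    relCap p ((fun x => a + r • x) ⁻¹' K) ((fun x => a + r • x) ⁻¹' E) =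
      ENNReal.ofReal r ^ (p - N) * relCap p K E := by
  refine (relCap_preimage_add_smul_le a hr hp K E).antisymm ?_
  have h := relCap_preimage_add_smul_le (-(r⁻¹ • a)) (inv_pos.2 hr) hp
    ((fun x => a + r • x) ⁻¹' K) ((fun x => a + r • x) ⁻¹' E)
  rwa [preimage_add_smul_preimage_inv a hr, preimage_add_smul_preimage_inv a hr,
    ENNReal.ofReal_inv_of_pos hr, ENNReal.inv_rpow,
    ← ENNReal.mul_le_iff_le_inv (ofReal_rpow_ne_zero hr _) (ofReal_rpow_ne_top hr _)] at h

theorem poincareConst_preimage_add_smul_le (hp : 0 < p) (Ω : Set (EuclideanSpace ℝ (Fin N))) :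
    poincareConst p ((fun x => a + r • x) ⁻¹' Ω) ≤ ENNReal.ofReal r ^ p * poincareConst p Ω := by
  rw [← ENNReal.inv_mul_le_iff (ofReal_rpow_ne_zero hr _) (ofReal_rpow_ne_top hr _)]
  refine le_poincareConst hp fun φ hφ => ?_
  have hrN : (ENNReal.ofReal r ^ N)⁻¹ ≠ 0 := by simp
  have hrN' : (ENNReal.ofReal r ^ N)⁻¹ ≠ ⊤ := by simp [hr]
  have h := poincareConst_mul_le hp (hφ.comp_add_smul a hr)
  rw [energy_comp_add_smul a hr hp.le φ, ofReal_rpow_sub_natCast hr,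
    lintegral_comp_add_smul volume (fun x => ‖φ x‖ₑ ^ p) a hr, finrank_euclideanSpace_fin,
    mul_left_comm, mul_right_comm, mul_comm _ (ENNReal.ofReal r ^ N)⁻¹,
    ENNReal.mul_le_mul_iff_right hrN hrN'] at h
  rwa [mul_assoc, ENNReal.inv_mul_le_iff (ofReal_rpow_ne_zero hr _) (ofReal_rpow_ne_top hr _)]

theorem poincareConst_preimage_add_smul (hp : 0 < p) (Ω : Set (EuclideanSpace ℝ (Fin N))) :
    poincareConst p ((fun x => a + r • x) ⁻¹' Ω) = ENNReal.ofReal r ^ p * poincareConst p Ω := by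
  refine (poincareConst_preimage_add_smul_le a hr hp Ω).antisymm ?_
  have h := poincareConst_preimage_add_smul_le (-(r⁻¹ • a)) (inv_pos.2 hr) hp
    ((fun x => a + r • x) ⁻¹' Ω)
  rwa [preimage_add_smul_preimage_inv a hr, ENNReal.ofReal_inv_of_pos hr, ENNReal.inv_rpow,
    ← ENNReal.mul_le_iff_le_inv (ofReal_rpow_ne_zero hr _) (ofReal_rpow_ne_top hr _)] at h

theorem preimage_add_smul_ball (y : EuclideanSpace ℝ (Fin N)) (s : ℝ) :
    (fun x => a + r • x) ⁻¹' ball (a + r • y) (r * s) = ball y s := by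
  ext x
  simp [dist_smul₀, abs_of_pos hr, hr]

theorem preimage_add_smul_closedBall (y : EuclideanSpace ℝ (Fin N)) (s : ℝ) :
    (fun x => a + r • x) ⁻¹' closedBall (a + r • y) (r * s) = closedBall y s := by
  ext x
  simp [dist_smul₀, abs_of_pos hr, hr]

theorem relCap_closedBall_ball_eq_rpow_mul (hp : 0 < p) (y : EuclideanSpace ℝ (Fin N)) (s t : ℝ) :
    relCap p (closedBall y s) (ball y t) =
      ENNReal.ofReal r ^ (p - N) * relCap p (closedBall (a + r • y) (r * s))
        (ball (a + r • y) (r * t)) := by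
  rw [← relCap_preimage_add_smul a hr hp, preimage_add_smul_closedBall a hr,
    preimage_add_smul_ball a hr]

theorem isNegligible_closedBall_diff_preimage_add_smul (hp : 0 < p) (γ : ℝ)
    (y : EuclideanSpace ℝ (Fin N)) (s : ℝ) (Ω : Set (EuclideanSpace ℝ (Fin N))) :
    IsNegligible p γ y s (closedBall y s \ (fun x => a + r • x) ⁻¹' Ω) ↔
      IsNegligible p γ (a + r • y) (r * s) (closedBall (a + r • y) (r * s) \ Ω) := by
  rw [IsNegligible, IsNegligible, mul_left_comm 2 r s, ← preimage_add_smul_ball a hr y (2 * s),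
    ← preimage_add_smul_closedBall a hr y s, ← preimage_sdiff, relCap_preimage_add_smul a hr hp,
    relCap_preimage_add_smul a hr hp, mul_left_comm (ENNReal.ofReal γ)]
  exact ENNReal.mul_le_mul_iff_right (ofReal_rpow_ne_zero hr _) (ofReal_rpow_ne_top hr _)

end Scaling

theorem relCap_closedBall_ball_translate (hp : 0 < p) (y : EuclideanSpace ℝ (Fin N)) (s t : ℝ) :
    relCap p (closedBall y s) (ball y t) =
      relCap p (closedBall (0 : EuclideanSpace ℝ (Fin N)) s) (ball 0 t) := by
  simpa using (relCap_closedBall_ball_eq_rpow_mul y one_pos hp 0 s t).symm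

/-- `η` is a smooth cutoff function between the concentric balls `closedBall y r` and `ball y R`,
with the bound `L` on its gradient. -/
structure IsCutoff (y : EuclideanSpace ℝ (Fin N)) (r R : ℝ) (L : NNReal)
    (η : EuclideanSpace ℝ (Fin N) → ℝ) : Prop where
  isTest : IsTest (ball y R) η
  nonneg : ∀ x, 0 ≤ η x
  le_one : ∀ x, η x ≤ 1
  eq_one : ∀ x ∈ closedBall y r, η x = 1
  enorm_fderiv_le : ∀ x, ‖fderiv ℝ η x‖ₑ ≤ L

theorem exists_isCutoff (N : ℕ) {r R : ℝ} (hr : 0 < r) (hR : r < R) :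
    ∃ L : NNReal, ∀ y : EuclideanSpace ℝ (Fin N), ∃ η, IsCutoff y r R L η := by
  let f : ContDiffBump (0 : EuclideanSpace ℝ (Fin N)) := ⟨r, (r + R) / 2, hr, by linarith⟩
  have hf : IsTest (ball 0 R) f := by
    refine ⟨f.contDiff, f.hasCompactSupport, ?_⟩
    rw [f.tsupport_eq]
    exact closedBall_subset_ball (show (r + R) / 2 < R by linarith)
  obtain ⟨C, hC⟩ := (f.hasCompactSupport.fderiv ℝ).exists_bound_of_continuous
    (hf.contDiff_one.continuous_fderiv one_ne_zero)
  refine ⟨C.toNNReal, fun y => ⟨fun x => f (-y + x), ?_, fun x => f.nonneg, fun x => f.le_one,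
    fun x hx => f.one_of_mem_closedBall ?_, fun x => ?_⟩⟩
  · have h := hf.comp_add_smul (-y) one_pos
    simpa [dist_eq_norm, preimage, ball, sub_eq_neg_add] using h
  · simpa [dist_eq_norm, sub_eq_neg_add] using hx
  · rw [fderiv_comp_add_left, ← ofReal_norm]
    exact ENNReal.ofReal_le_ofReal (hC _)

namespace IsCutoff

variable {y : EuclideanSpace ℝ (Fin N)} {r R : ℝ} {L : NNReal}
  {η f : EuclideanSpace ℝ (Fin N) → ℝ}

theorem enorm_le_one (h : IsCutoff y r R L η) (x : EuclideanSpace ℝ (Fin N)) : ‖η x‖ₑ ≤ 1 := by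
  simpa [Real.enorm_eq_ofReal (h.nonneg x)] using h.le_one x

theorem enorm_fderiv_mul_le (h : IsCutoff y r R L η) {x : EuclideanSpace ℝ (Fin N)}
    (hf : DifferentiableAt ℝ f x) :
    ‖fderiv ℝ (fun x => η x * f x) x‖ₑ ≤ L * ‖f x‖ₑ + ‖fderiv ℝ f x‖ₑ := by
  rw [fderiv_fun_mul (h.isTest.differentiable x) hf, add_comm (L * ‖f x‖ₑ)]
  refine (enorm_add_le (η x • fderiv ℝ f x) (f x • fderiv ℝ η x)).trans ?_
  rw [enorm_smul, enorm_smul, mul_comm ‖f x‖ₑ]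
  exact add_le_add (mul_le_of_le_one_left' (h.enorm_le_one x))
    (mul_le_mul_left (h.enorm_fderiv_le x) _)

theorem energy_mul_le (hp : 1 ≤ p) (h : IsCutoff y r R L η) (hf : ContDiff ℝ ∞ f) :
    energy p (fun x => η x * f x) ≤ 2 ^ (p - 1) *
      (L ^ p * (∫⁻ x in ball y R, ‖f x‖ₑ ^ p) + ∫⁻ x in ball y R, ‖fderiv ℝ f x‖ₑ ^ p) := by
  have hp0 : 0 < p := by linarith
  have h2 : (2 : ℝ≥0∞) ^ (p - 1) ≠ ⊤ :=
    ENNReal.rpow_ne_top_of_nonneg (by linarith) ENNReal.ofNat_ne_top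
  rw [← setLIntegral_fderiv_eq_energy hp0 (h.isTest.mul_contDiff hf).2.2,
    ← lintegral_const_mul' _ _ (ENNReal.rpow_ne_top_of_nonneg hp0.le ENNReal.coe_ne_top),
    ← lintegral_add_left ((hf.continuous.enorm.measurable.pow_const p).const_mul _),
    ← lintegral_const_mul' _ _ h2]
  refine lintegral_mono fun x => ?_
  calc ‖fderiv ℝ (fun x => η x * f x) x‖ₑ ^ p
    _ ≤ (L * ‖f x‖ₑ + ‖fderiv ℝ f x‖ₑ) ^ p :=
      ENNReal.rpow_le_rpow (h.enorm_fderiv_mul_le (hf.differentiable (by simp) x)) hp0.le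
    _ ≤ 2 ^ (p - 1) * ((L * ‖f x‖ₑ) ^ p + ‖fderiv ℝ f x‖ₑ ^ p) :=
      ENNReal.rpow_add_le_mul_rpow_add_rpow _ _ hp
    _ = 2 ^ (p - 1) * (L ^ p * ‖f x‖ₑ ^ p + ‖fderiv ℝ f x‖ₑ ^ p) := by
      rw [ENNReal.mul_rpow_of_nonneg _ _ hp0.le]

end IsCutoff

theorem relCap_closedBall_lt_top (hp : 0 < p) {r R : ℝ} (hr : 0 < r) (hR : r < R)
    (y : EuclideanSpace ℝ (Fin N)) : relCap p (closedBall y r) (ball y R) < ⊤ := by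
  obtain ⟨L, hL⟩ := exists_isCutoff N hr hR
  obtain ⟨η, hη⟩ := hL y
  calc relCap p (closedBall y r) (ball y R)
    _ ≤ energy p η := relCap_le hp hη.isTest fun x hx => (hη.eq_one x hx).ge
    _ = ∫⁻ x in ball y R, ‖fderiv ℝ η x‖ₑ ^ p :=
      (setLIntegral_fderiv_eq_energy hp hη.isTest.2.2).symm
    _ ≤ ∫⁻ _ in ball y R, (L : ℝ≥0∞) ^ p :=
      lintegral_mono fun x => ENNReal.rpow_le_rpow (hη.enorm_fderiv_le x) hp.le
    _ = L ^ p * volume (ball y R) := setLIntegral_const _ _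
    _ < ⊤ := ENNReal.mul_lt_top (ENNReal.rpow_lt_top_of_nonneg hp.le ENNReal.coe_ne_top)
      measure_ball_lt_top

theorem ediam_ball_le {X : Type*} [PseudoMetricSpace X] (x : X) (r : ℝ) :
    ediam (ball x r) ≤ ENNReal.ofReal (2 * r) := by
  rw [ENNReal.ofReal_mul zero_le_two, ENNReal.ofReal_ofNat, ← eball_ofReal]
  exact ediam_eball_le

theorem le_poincareConst_of_forall_ball (hp : 0 < p) {s : ℝ} (hs : 0 < s)
    (h : ∀ φ, IsTest Ω φ → ∀ y, b * ∫⁻ x in ball y s, ‖φ x‖ₑ ^ p ≤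
      ∫⁻ x in ball y s, ‖fderiv ℝ φ x‖ₑ ^ p) :
    b ≤ poincareConst p Ω := by
  refine le_poincareConst hp fun φ hφ => ?_
  have hfderiv : Continuous fun x => ‖fderiv ℝ φ x‖ₑ ^ p := by
    have := hφ.contDiff_one
    fun_prop (disch := simp)
  have hsum : volume (ball (0 : EuclideanSpace ℝ (Fin N)) s) * (b * ∫⁻ x, ‖φ x‖ₑ ^ p) ≤
      volume (ball (0 : EuclideanSpace ℝ (Fin N)) s) * energy p φ := by
    rw [energy, mul_left_comm, ← lintegral_setLIntegral_ball volume hfderiv.measurable,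
      ← lintegral_setLIntegral_ball volume
        (hφ.1.continuous.enorm.measurable.pow_const p)]
    exact (lintegral_const_mul_le _ _).trans (lintegral_mono fun y => h φ hφ y)
  exact (ENNReal.mul_le_mul_iff_right (measure_ball_pos _ _ hs).ne' measure_ball_lt_top.ne).1 hsum

theorem le_poincareConst_of_volume_le (hp : 1 ≤ p) {s : ℝ} (hs : 0 < s)
    (hΩ : 2 * volume Ω ≤ volume (ball (0 : EuclideanSpace ℝ (Fin N)) s)) :
    (2 * (ENNReal.ofReal (2 * s) ^ p * 2 ^ N))⁻¹ ≤ poincareConst p Ω := by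
  refine le_poincareConst_of_forall_ball (by linarith) hs fun φ hφ y => ?_
  set V := volume (ball y s)
  set Z := volume (ball y s ∩ {x | φ x = 0})
  set G := ∫⁻ x in ball y s, ‖fderiv ℝ φ x‖ₑ ^ p
  have hV0 : V ≠ 0 := (measure_ball_pos _ _ hs).ne'
  have hVtop : V ≠ ⊤ := measure_ball_lt_top.ne
  have hcover : V ≤ Z + volume Ω := by
    refine (measure_mono fun x hx => ?_).trans (measure_union_le _ _)
    by_cases hxΩ : x ∈ Ω
    · exact Or.inr hxΩ
    · exact Or.inl ⟨hx, hφ.eq_zero_of_notMem hxΩ⟩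
  have hne : 2 * (ENNReal.ofReal (2 * s) ^ p * 2 ^ N) ≠ 0 :=
    mul_ne_zero two_ne_zero (mul_ne_zero (ofReal_rpow_ne_zero (by positivity) p) (by simp))
  have htop : 2 * (ENNReal.ofReal (2 * s) ^ p * 2 ^ N) ≠ ⊤ := by finiteness
  have hzeros : V ≤ 2 * Z := by
    rw [← Measure.addHaar_ball_center volume y s] at hΩ
    refine (ENNReal.add_le_add_iff_right hVtop).1 ?_
    calc V + V ≤ 2 * (Z + volume Ω) := by rw [← two_mul]; gcongr
      _ = 2 * Z + 2 * volume Ω := mul_add _ _ _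
      _ ≤ 2 * Z + V := by gcongr
  rw [ENNReal.inv_mul_le_iff hne htop,
    ← ENNReal.mul_le_mul_iff_right hV0 hVtop]
  calc V * ∫⁻ x in ball y s, ‖φ x‖ₑ ^ p
    _ ≤ 2 * (Z * ∫⁻ x in ball y s, ‖φ x‖ₑ ^ p) := by rw [← mul_assoc]; gcongr
    _ ≤ 2 * (ediam (ball y s) ^ p * 2 ^ N * V * G) := by
      refine mul_le_mul_right ?_ _
      simpa using measure_inter_zeros_mul_setLIntegral_le volume hp hφ.contDiff_one
        measurableSet_ball (convex_ball y s) isBounded_ball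
    _ ≤ 2 * (ENNReal.ofReal (2 * s) ^ p * 2 ^ N * V * G) := by
      gcongr
      exact ediam_ball_le y s
    _ = V * (2 * (ENNReal.ofReal (2 * s) ^ p * 2 ^ N) * G) := by ring

theorem poincareConst_ne_zero_of_volume_ne_top [NeZero N] (hp : 1 ≤ p) (hΩ : volume Ω ≠ ⊤) :
    poincareConst p Ω ≠ 0 := by
  have hlim :
      Tendsto (fun n : ℕ => volume (ball (0 : EuclideanSpace ℝ (Fin N)) n)) atTop (𝓝 ⊤) := by
    have h := tendsto_measure_iUnion_atTop (μ := volume)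
      (s := fun n : ℕ => ball (0 : EuclideanSpace ℝ (Fin N)) n)
      fun m n hmn => ball_subset_ball (by exact_mod_cast hmn)
    rwa [iUnion_ball_nat, measure_univ_of_isAddLeftInvariant] at h
  have h2Ω : 2 * volume Ω < ⊤ := ENNReal.mul_lt_top ENNReal.ofNat_lt_top hΩ.lt_top
  obtain ⟨n, hn, hn0⟩ := ((hlim.eventually_const_lt h2Ω).and (eventually_gt_atTop 0)).exists
  have hpos : (2 * (ENNReal.ofReal (2 * n) ^ p * 2 ^ N))⁻¹ ≠ 0 := by
    rw [ENNReal.inv_ne_zero]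
    finiteness
  exact (hpos.bot_lt.trans_le
    (le_poincareConst_of_volume_le hp (by exact_mod_cast hn0) hn.le)).ne'

theorem poincareConst_mul_volume_le_relCap (hp : 0 < p) :
    poincareConst p E * volume K ≤ relCap p K E := by
  refine le_relCap hp fun φ hφ hK => le_trans ?_ (poincareConst_mul_le hp hφ)
  gcongr
  calc volume K ≤ volume {x | 1 ≤ ‖φ x‖ₑ ^ p} := measure_mono fun x hx =>
        ENNReal.one_le_rpow (by
          simpa [Real.enorm_eq_ofReal_abs] using (hK x hx).trans (le_abs_self _)) hp
    _ ≤ ∫⁻ x, ‖φ x‖ₑ ^ p := by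
      simpa using mul_meas_ge_le_lintegral (hφ.1.continuous.enorm.measurable.pow_const p) 1

theorem relCap_ne_zero [NeZero N] (hp : 1 ≤ p) (hE : volume E ≠ ⊤) (hK : volume K ≠ 0) :
    relCap p K E ≠ 0 :=
  ((mul_ne_zero (poincareConst_ne_zero_of_volume_ne_top hp hE) hK).bot_lt.trans_le
    (poincareConst_mul_volume_le_relCap (by linarith))).ne'

theorem relCap_closedBall_ne_zero [NeZero N] (hp : 1 ≤ p) {r : ℝ} (hr : 0 < r)
    (y : EuclideanSpace ℝ (Fin N)) (R : ℝ) : relCap p (closedBall y r) (ball y R) ≠ 0 :=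
  relCap_ne_zero hp measure_ball_lt_top.ne (measure_closedBall_pos _ _ hr).ne'

/-! ### The Maz'ya–Poincaré inequality -/

theorem setLIntegral_enorm_rpow_le_add {X : Type*} [MeasurableSpace X] (μ : Measure X) (hp : 1 ≤ p)
    (s : Set X) (u : X → ℝ) (m : ℝ) :
    ∫⁻ x in s, ‖u x‖ₑ ^ p ∂μ ≤
      2 ^ (p - 1) * ((∫⁻ x in s, ‖u x - m‖ₑ ^ p ∂μ) + ‖m‖ₑ ^ p * μ s) := by
  have h2 : (2 : ℝ≥0∞) ^ (p - 1) ≠ ⊤ :=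
    ENNReal.rpow_ne_top_of_nonneg (by linarith) ENNReal.ofNat_ne_top
  rw [← setLIntegral_const, ← lintegral_add_right _ measurable_const,
    ← lintegral_const_mul' _ _ h2]
  refine lintegral_mono fun x => ?_
  calc ‖u x‖ₑ ^ p = ‖(u x - m) + m‖ₑ ^ p := by rw [sub_add_cancel]
    _ ≤ (‖u x - m‖ₑ + ‖m‖ₑ) ^ p := ENNReal.rpow_le_rpow (enorm_add_le _ _) (by linarith)
    _ ≤ 2 ^ (p - 1) * (‖u x - m‖ₑ ^ p + ‖m‖ₑ ^ p) := ENNReal.rpow_add_le_mul_rpow_add_rpow _ _ hp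

theorem IsCutoff.relCap_mul_enorm_rpow_le (hp : 1 ≤ p) {y : EuclideanSpace ℝ (Fin N)} {r R : ℝ}
    {L : NNReal} {η u : EuclideanSpace ℝ (Fin N) → ℝ} (hη : IsCutoff y r R L η)
    (hK : K ⊆ closedBall y r) (hu : ContDiff ℝ ∞ u) (hu0 : ∀ x ∈ K, u x = 0) (m : ℝ) :
    relCap p K (ball y R) * ‖m‖ₑ ^ p ≤ 2 ^ (p - 1) *
      (L ^ p * (∫⁻ x in ball y R, ‖u x - m‖ₑ ^ p) + ∫⁻ x in ball y R, ‖fderiv ℝ u x‖ₑ ^ p) := by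
  have hf : ContDiff ℝ ∞ fun x => m - u x := contDiff_const.sub hu
  have hfK (x) (hx : x ∈ K) : η x * (m - u x) = m := by
    rw [hη.eq_one x (hK hx), hu0 x hx, one_mul, sub_zero]
  calc relCap p K (ball y R) * ‖m‖ₑ ^ p
    _ ≤ energy p (fun x => η x * (m - u x)) :=
      CapInradius.relCap_mul_enorm_rpow_le (by linarith) (hη.isTest.mul_contDiff hf) hfK
    _ ≤ _ := hη.energy_mul_le hp hf
    _ = _ := by simp only [enorm_sub_rev m, fderiv_const_sub, enorm_neg]

theorem exists_setLIntegral_ball_enorm_sub_rpow_le (hp : 1 ≤ p)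
    {u : EuclideanSpace ℝ (Fin N) → ℝ} (hu : ContDiff ℝ 1 u) (y : EuclideanSpace ℝ (Fin N)) {R : ℝ}
    (hR : 0 < R) :
    ∃ m, ∫⁻ x in ball y R, ‖u x - m‖ₑ ^ p ≤
      ENNReal.ofReal (2 * R) ^ p * 2 ^ N * ∫⁻ x in ball y R, ‖fderiv ℝ u x‖ₑ ^ p := by
  obtain ⟨z, -, hz⟩ := exists_setLIntegral_enorm_sub_rpow_le volume hp hu measurableSet_ball
    (convex_ball y R) isBounded_ball (measure_ball_pos volume y hR).ne'
  rw [finrank_euclideanSpace_fin] at hz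
  exact ⟨u z, hz.trans (by gcongr; exact ediam_ball_le y R)⟩

theorem exists_relCap_mul_setLIntegral_le (N : ℕ) (hp : 1 ≤ p) {r R : ℝ} (hr : 0 < r)
    (hR : r < R) :
    ∃ M : ℝ≥0∞, M ≠ ⊤ ∧ ∀ (y : EuclideanSpace ℝ (Fin N)), ∀ K ⊆ closedBall y r,
      ∀ u : EuclideanSpace ℝ (Fin N) → ℝ, ContDiff ℝ ∞ u → (∀ x ∈ K, u x = 0) →
      relCap p K (ball y R) * ∫⁻ x in ball y R, ‖u x‖ₑ ^ p ≤
        M * ∫⁻ x in ball y R, ‖fderiv ℝ u x‖ₑ ^ p := by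
  have hp0 : 0 < p := by linarith
  obtain ⟨L, hL⟩ := exists_isCutoff N hr hR
  have hc := (relCap_closedBall_lt_top hp0 hr hR (0 : EuclideanSpace ℝ (Fin N))).ne
  set c := relCap p (closedBall (0 : EuclideanSpace ℝ (Fin N)) r) (ball 0 R)
  have hW := (measure_ball_lt_top (μ := volume) (x := (0 : EuclideanSpace ℝ (Fin N))) (r := R)).ne
  set W := volume (ball (0 : EuclideanSpace ℝ (Fin N)) R)
  have hA : ENNReal.ofReal (2 * R) ^ p * 2 ^ N ≠ ⊤ := by finiteness
  set A : ℝ≥0∞ := ENNReal.ofReal (2 * R) ^ p * 2 ^ N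
  have hD : 2 ^ (p - 1) * (L ^ p * A + 1) ≠ ⊤ := by finiteness
  set D : ℝ≥0∞ := 2 ^ (p - 1) * (L ^ p * A + 1) with hD_def
  refine ⟨2 ^ (p - 1) * (c * A + D * W), by finiteness, fun y K hK u hu hu0 => ?_⟩
  set G := ∫⁻ x in ball y R, ‖fderiv ℝ u x‖ₑ ^ p
  have hVy : volume (ball y R) = W := Measure.addHaar_ball_center _ _ _
  have hcy : relCap p K (ball y R) ≤ c :=
    (relCap_mono hp0 hK Subset.rfl).trans_eq (relCap_closedBall_ball_translate hp0 y r R)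
  obtain ⟨m, hosc⟩ := exists_setLIntegral_ball_enorm_sub_rpow_le hp
    (hu.of_le (by exact_mod_cast le_top)) y (hr.trans hR)
  have hmean : relCap p K (ball y R) * ‖m‖ₑ ^ p ≤ D * G := by
    obtain ⟨η, hη⟩ := hL y
    calc relCap p K (ball y R) * ‖m‖ₑ ^ p
      _ ≤ _ := hη.relCap_mul_enorm_rpow_le hp hK hu hu0 m
      _ ≤ 2 ^ (p - 1) * (L ^ p * (A * G) + G) := by gcongr
      _ = D * G := by rw [hD_def]; ring
  calc relCap p K (ball y R) * ∫⁻ x in ball y R, ‖u x‖ₑ ^ p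
    _ ≤ relCap p K (ball y R) * (2 ^ (p - 1) * (A * G + ‖m‖ₑ ^ p * W)) := by
      gcongr
      rw [← hVy]
      exact (setLIntegral_enorm_rpow_le_add volume hp _ u m).trans (by gcongr)
    _ = 2 ^ (p - 1) * (relCap p K (ball y R) * (A * G) +
        relCap p K (ball y R) * ‖m‖ₑ ^ p * W) := by ring
    _ ≤ 2 ^ (p - 1) * (c * (A * G) + D * G * W) :=
      mul_le_mul_right (add_le_add (mul_le_mul_left hcy _) (mul_le_mul_left hmean W)) _
    _ = 2 ^ (p - 1) * (c * A + D * W) * G := by ring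

theorem exists_mul_le_poincareConst_of_forall_not_isNegligible (N : ℕ) [NeZero N] (hp : 1 ≤ p) :
    ∃ κ : ℝ≥0∞, κ ≠ 0 ∧ κ ≠ ⊤ ∧ ∀ (γ : ℝ) (Ω : Set (EuclideanSpace ℝ (Fin N))),
      (∀ y, ¬ IsNegligible p γ y 1 (closedBall y 1 \ Ω)) →
        ENNReal.ofReal γ * κ ≤ poincareConst p Ω := by
  have hp0 : 0 < p := by linarith
  obtain ⟨M, hM, hmazya⟩ := exists_relCap_mul_setLIntegral_le N hp one_pos one_lt_two
  set c := relCap p (closedBall (0 : EuclideanSpace ℝ (Fin N)) 1) (ball 0 2)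
  have hc0 : c ≠ 0 := relCap_closedBall_ne_zero hp one_pos 0 2
  have hctop : c ≠ ⊤ := (relCap_closedBall_lt_top hp0 one_pos one_lt_two 0).ne
  refine ⟨c / (M + 1), by simp [hc0, hM], ENNReal.div_ne_top hctop (by simp),
    fun γ Ω hΩ => le_poincareConst_of_forall_ball hp0 two_pos fun u hu y => ?_⟩
  have hcap : ENNReal.ofReal γ * c ≤ relCap p (closedBall y 1 \ Ω) (ball y 2) := by
    have h := hΩ y
    rw [IsNegligible, mul_one, relCap_closedBall_ball_translate hp0] at h
    exact (not_le.1 h).le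
  rw [← mul_div_assoc, div_eq_mul_inv, mul_right_comm, ← div_eq_mul_inv]
  refine ENNReal.div_le_of_le_mul' ?_
  calc ENNReal.ofReal γ * c * ∫⁻ x in ball y 2, ‖u x‖ₑ ^ p
    _ ≤ relCap p (closedBall y 1 \ Ω) (ball y 2) * ∫⁻ x in ball y 2, ‖u x‖ₑ ^ p := by gcongr
    _ ≤ M * ∫⁻ x in ball y 2, ‖fderiv ℝ u x‖ₑ ^ p :=
      hmazya y _ sdiff_subset u hu.1 fun x hx => hu.eq_zero_of_notMem hx.2
    _ ≤ (M + 1) * ∫⁻ x in ball y 2, ‖fderiv ℝ u x‖ₑ ^ p := by gcongr; exact le_self_add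

theorem mul_inv_rpow_le_of_forall_lt (hp : 0 < p) {a R l : ℝ≥0∞}
    (h : ∀ r : ℝ, R < ENNReal.ofReal r → a ≤ l * ENNReal.ofReal r ^ p) : a * R⁻¹ ^ p ≤ l := by
  rcases eq_or_ne R ⊤ with rfl | hR
  · simp [hp]
  rcases eq_or_ne l ⊤ with rfl | hl
  · exact le_top
  have hcont : ContinuousAt (fun r : ℝ => l * ENNReal.ofReal r ^ p) R.toReal := by
    refine ENNReal.Tendsto.const_mul ?_ (Or.inr hl)
    exact (ENNReal.continuous_rpow_const.comp ENNReal.continuous_ofReal).continuousAt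
  have hlim : a ≤ l * ENNReal.ofReal R.toReal ^ p := by
    refine ge_of_tendsto (hcont.tendsto.mono_left (nhdsWithin_le_nhds (s := Ioi R.toReal))) ?_
    exact eventually_mem_nhdsWithin.mono fun r hr =>
      h r ((ENNReal.lt_ofReal_iff_toReal_lt hR).2 hr)
  rw [ENNReal.inv_rpow, ← div_eq_mul_inv]
  exact ENNReal.div_le_of_le_mul (by rwa [ENNReal.ofReal_toReal hR] at hlim)

theorem exists_mul_inv_capInradius_rpow_le_poincareConst (N : ℕ) [NeZero N] (hp : 1 ≤ p) :
    ∃ σ : ℝ, 0 < σ ∧ ∀ (γ : ℝ) (Ω : Set (EuclideanSpace ℝ (Fin N))),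
      ENNReal.ofReal (σ * γ) * (capInradius p γ Ω)⁻¹ ^ p ≤ poincareConst p Ω := by
  have hp0 : 0 < p := by linarith
  obtain ⟨κ, hκ0, hκtop, hκ⟩ := exists_mul_le_poincareConst_of_forall_not_isNegligible N hp
  refine ⟨κ.toReal, ENNReal.toReal_pos hκ0 hκtop, fun γ Ω => ?_⟩
  rw [ENNReal.ofReal_mul ENNReal.toReal_nonneg, ENNReal.ofReal_toReal hκtop, mul_comm κ]
  refine mul_inv_rpow_le_of_forall_lt hp0 fun r hr => ?_
  have hr0 : 0 < r := ENNReal.ofReal_pos.1 (bot_le.trans_lt hr)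
  rw [mul_comm (poincareConst p Ω), ← poincareConst_preimage_add_smul 0 hr0 hp0]
  refine hκ γ _ fun y hy => hr.not_ge ?_
  rw [isNegligible_closedBall_diff_preimage_add_smul 0 hr0 hp0, mul_one] at hy
  exact ofReal_le_capInradius hr0 hy

/-! ### Left-continuity of the capacity in the radius -/

/-- `h` is a smooth version of the truncation `t ↦ max 0 (min t 1)`, equal to one already on
`[1 - δ, ∞)` and with slope at most `1 + ε`. -/
structure IsTruncation (ε δ : ℝ) (h : ℝ → ℝ) : Prop where
  contDiff : ContDiff ℝ ∞ h
  nonneg : ∀ t, 0 ≤ h t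
  le_one : ∀ t, h t ≤ 1
  zero : h 0 = 0
  eq_one : ∀ t, 1 - δ ≤ t → h t = 1
  enorm_deriv_le : ∀ t, ‖deriv h t‖ₑ ≤ ENNReal.ofReal (1 + ε)

theorem isTruncation_integral {ε δ : ℝ} {f : ℝ → ℝ} (hf : ContDiff ℝ ∞ f)
    (hf0 : ∀ t, 0 ≤ f t) (hfε : ∀ t, f t ≤ 1 + ε) (hsupp : Function.support f ⊆ Ioc 0 (1 - δ))
    (hint : ∫ t, f t = 1) : IsTruncation ε δ (fun t => ∫ s in (0)..t, f s) := by
  have hderiv (t : ℝ) : HasDerivAt (fun t => ∫ s in (0)..t, f s) (f t) t :=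
    intervalIntegral.integral_hasDerivAt_right (hf.continuous.intervalIntegrable 0 t)
      hf.continuous.stronglyMeasurable.stronglyMeasurableAtFilter hf.continuous.continuousAt
  have hone (t : ℝ) (ht : 1 - δ ≤ t) : ∫ s in (0)..t, f s = 1 := by
    rw [intervalIntegral.integral_eq_integral_of_support_subset
      (hsupp.trans (Ioc_subset_Ioc_right ht)), hint]
  have hmono : Monotone fun t => ∫ s in (0)..t, f s :=
    monotone_of_hasDerivAt_nonneg hderiv hf0
  have hneg (t : ℝ) (ht : t ≤ 0) : ∫ s in (0)..t, f s = 0 := by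
    rw [intervalIntegral.integral_of_ge ht, setIntegral_eq_zero_of_forall_eq_zero, neg_zero]
    exact fun s hs => by_contra fun h0 => hs.2.not_gt (hsupp h0).1
  exact {
    contDiff := by
      rw [contDiff_infty_iff_deriv, funext fun t => (hderiv t).deriv]
      exact ⟨fun t => (hderiv t).differentiableAt, hf⟩
    nonneg := fun t => (hneg (min t 0) (min_le_right _ _)).symm.trans_le (hmono (min_le_left _ _))
    le_one := fun t =>
      (hmono (le_max_left _ _)).trans_eq (hone (max t (1 - δ)) (le_max_right _ _))
    zero := intervalIntegral.integral_same
    eq_one := hone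
    enorm_deriv_le := fun t => by
      rw [(hderiv t).deriv, Real.enorm_eq_ofReal (hf0 t)]
      exact ENNReal.ofReal_le_ofReal (hfε t) }

theorem exists_isTruncation {ε : ℝ} (hε : 0 < ε) : ∃ δ > 0, ∃ h, IsTruncation ε δ h := by
  set δ := ε / (3 * (1 + ε)) with hδ_def
  have hδ : 0 < δ := by positivity
  have hεδ : (1 - 3 * δ) * (1 + ε) = 1 := by
    rw [hδ_def]
    field_simp
    ring
  have hδ3 : 0 < 1 - 3 * δ := by nlinarith
  let f : ContDiffBump ((1 - δ) / 2) :=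
    ⟨(1 - 3 * δ) / 2, (1 - δ) / 2, by linarith, by linarith⟩
  refine ⟨δ, hδ, _, isTruncation_integral (f.contDiff_normed (μ := volume))
    (fun t => f.nonneg_normed t) (fun t => ?_) ?_ f.integral_normed⟩
  · refine (f.normed_le_div_measure_closedBall_rIn volume t).trans_eq ?_
    rw [Real.volume_real_closedBall f.rIn_pos.le, show 2 * f.rIn = 1 - 3 * δ by ring]
    rw [one_div, inv_eq_of_mul_eq_one_right hεδ]
  · rw [f.support_normed_eq, Real.ball_eq_Ioo]
    refine Ioo_subset_Ioc_self.trans_eq ?_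
    change Ioc ((1 - δ) / 2 - (1 - δ) / 2) ((1 - δ) / 2 + (1 - δ) / 2) = _
    rw [sub_self, add_halves]

theorem exists_pos_ofReal_rpow_mul_lt {a : ℝ≥0∞} (h : b < a) (q : ℝ) :
    ∃ ε : ℝ, 0 < ε ∧ ENNReal.ofReal (1 + ε) ^ q * b < a := by
  have hcont : ContinuousAt (fun ε : ℝ => ENNReal.ofReal (1 + ε) ^ q * b) 0 := by
    refine ENNReal.Tendsto.mul_const ?_ (Or.inl (by simp))
    exact (ENNReal.continuous_rpow_const.comp
      (ENNReal.continuous_ofReal.comp (continuous_const.add continuous_id))).continuousAt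
  have hlt : ∀ᶠ ε in 𝓝 (0 : ℝ), ENNReal.ofReal (1 + ε) ^ q * b < a :=
    hcont.tendsto.eventually_lt_const (by simpa using h)
  obtain ⟨ε, hεa, hε⟩ := ((hlt.filter_mono (nhdsWithin_le_nhds (s := Ioi 0))).and
    self_mem_nhdsWithin).exists
  exact ⟨ε, hε, hεa⟩

theorem IsTruncation.energy_comp_le (hp : 0 ≤ p) {ε δ : ℝ} {h : ℝ → ℝ} (hh : IsTruncation ε δ h)
    (hφ : Differentiable ℝ φ) : energy p (h ∘ φ) ≤ ENNReal.ofReal (1 + ε) ^ p * energy p φ := by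
  unfold energy
  rw [← lintegral_const_mul' _ _ (ENNReal.rpow_ne_top_of_nonneg hp ENNReal.ofReal_ne_top)]
  refine lintegral_mono fun x => ?_
  have hderiv := (hh.contDiff.differentiable (by simp) (φ x)).hasDerivAt.comp_hasFDerivAt x
    (hφ x).hasFDerivAt
  rw [hderiv.fderiv, enorm_smul, ENNReal.mul_rpow_of_nonneg _ _ hp]
  exact mul_le_mul_left (ENNReal.rpow_le_rpow (hh.enorm_deriv_le _) hp) _

theorem IsTruncation.isTest_comp {ε δ : ℝ} {h : ℝ → ℝ} (hh : IsTruncation ε δ h)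
    (hφ : IsTest E φ) : IsTest E (h ∘ φ) :=
  ⟨hh.contDiff.comp hφ.1, hφ.2.1.comp_left hh.zero,
    (tsupport_comp_subset hh.zero φ).trans hφ.2.2⟩

theorem exists_normalized_of_relCap_lt (hp : 0 < p) (h : relCap p K E < b) :
    ∃ φ, IsTest E φ ∧ (∀ x, 0 ≤ φ x) ∧ (∀ x, φ x ≤ 1) ∧ (∀ x ∈ K, φ =ᶠ[𝓝 x] 1) ∧
      energy p φ < b := by
  obtain ⟨φ, hφ, hφK, hφb⟩ := exists_energy_lt_of_relCap_lt hp h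
  obtain ⟨ε, hε, hεb⟩ := exists_pos_ofReal_rpow_mul_lt hφb p
  obtain ⟨δ, hδ, g, hg⟩ := exists_isTruncation hε
  refine ⟨g ∘ φ, hg.isTest_comp hφ, fun x => hg.nonneg _, fun x => hg.le_one _, fun x hx => ?_,
    (hg.energy_comp_le hp.le hφ.differentiable).trans_lt hεb⟩
  have hnear : ∀ᶠ z in 𝓝 x, 1 - δ < φ z :=
    hφ.1.continuous.continuousAt.eventually_const_lt (by linarith [hφK x hx])
  exact hnear.mono fun z hz => hg.eq_one _ hz.le

section Deformation

theorem energy_comp_le_of_injective (hp : 0 ≤ p) (hb : b ≠ ⊤)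
    {F : EuclideanSpace ℝ (Fin N) → EuclideanSpace ℝ (Fin N)}
    {F' : EuclideanSpace ℝ (Fin N) → EuclideanSpace ℝ (Fin N) →L[ℝ] EuclideanSpace ℝ (Fin N)}
    (hF : ∀ x, HasFDerivAt F (F' x) x) (hinj : Function.Injective F) (hnorm : ∀ x, ‖F' x‖ₑ ≤ b)
    (hdet : ∀ x, 1 ≤ b * ENNReal.ofReal |(F' x).det|) (hφ : Differentiable ℝ φ) :
    energy p (fun x => φ (F x)) ≤ b ^ (p + 1) * energy p φ := by
  have hpoint (x : EuclideanSpace ℝ (Fin N)) : ‖fderiv ℝ (fun x => φ (F x)) x‖ₑ ^ p ≤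
      b ^ (p + 1) * (ENNReal.ofReal |(F' x).det| * ‖fderiv ℝ φ (F x)‖ₑ ^ p) := by
    have hchain : fderiv ℝ (fun x => φ (F x)) x = (fderiv ℝ φ (F x)).comp (F' x) :=
      ((hφ (F x)).hasFDerivAt.comp x (hF x)).fderiv
    calc ‖fderiv ℝ (fun x => φ (F x)) x‖ₑ ^ p
      _ ≤ (‖fderiv ℝ φ (F x)‖ₑ * ‖F' x‖ₑ) ^ p := by
        rw [hchain]
        exact ENNReal.rpow_le_rpow (ContinuousLinearMap.opENorm_comp_le _ _) hp
      _ ≤ (‖fderiv ℝ φ (F x)‖ₑ * b) ^ p :=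
        ENNReal.rpow_le_rpow (mul_le_mul_right (hnorm x) _) hp
      _ = b ^ p * (1 * ‖fderiv ℝ φ (F x)‖ₑ ^ p) := by
        rw [ENNReal.mul_rpow_of_nonneg _ _ hp, one_mul, mul_comm]
      _ ≤ b ^ p * (b * ENNReal.ofReal |(F' x).det| * ‖fderiv ℝ φ (F x)‖ₑ ^ p) :=
        mul_le_mul_right (mul_le_mul_left (hdet x) _) _
      _ = _ := by
        rw [ENNReal.rpow_add_of_nonneg _ _ hp zero_le_one, ENNReal.rpow_one]
        ring
  calc energy p (fun x => φ (F x))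
    _ ≤ b ^ (p + 1) * ∫⁻ x, ENNReal.ofReal |(F' x).det| * ‖fderiv ℝ φ (F x)‖ₑ ^ p := by
      rw [← lintegral_const_mul' _ _ (ENNReal.rpow_ne_top_of_nonneg (by linarith) hb)]
      exact lintegral_mono hpoint
    _ = b ^ (p + 1) * ∫⁻ x in F '' univ, ‖fderiv ℝ φ x‖ₑ ^ p := by
      rw [lintegral_image_eq_lintegral_abs_det_fderiv_mul volume MeasurableSet.univ
        (fun x _ => (hF x).hasFDerivWithinAt) hinj.injOn, Measure.restrict_univ]
    _ ≤ b ^ (p + 1) * energy p φ := mul_le_mul_right (setLIntegral_le_lintegral _ _) _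

theorem eventually_enorm_le_and_one_le_mul_det {V : Type*} [NormedAddCommGroup V]
    [NormedSpace ℝ V] [FiniteDimensional ℝ V] (hb : 1 < b) (hb_top : b ≠ ⊤) :
    ∀ᶠ A in 𝓝 (1 : V →L[ℝ] V), ‖A‖ₑ ≤ b ∧ 1 ≤ b * ENNReal.ofReal |A.det| := by
  have hid : ‖(1 : V →L[ℝ] V)‖ₑ ≤ 1 := by
    rw [← ofReal_norm]
    exact ENNReal.ofReal_le_one.2 ContinuousLinearMap.norm_id_le
  have hdet : Tendsto (fun A : V →L[ℝ] V => b * ENNReal.ofReal |A.det|) (𝓝 1) (𝓝 b) := by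
    have h := ENNReal.Tendsto.const_mul (a := b) (ENNReal.tendsto_ofReal
      (ContinuousLinearMap.continuous_det.abs.tendsto (1 : V →L[ℝ] V))) (Or.inr hb_top)
    simpa [ContinuousLinearMap.det] using h
  exact ((continuous_enorm.tendsto 1).eventually_le_const (hid.trans_lt hb)).and
    (hdet.eventually_const_le hb)

variable {V : Type*} [NormedAddCommGroup V] [NormedSpace ℝ V] {G : V → V} {L : NNReal}

theorem eventually_injective_sub_smul (hG : LipschitzWith L G) :
    ∀ᶠ θ in 𝓝 (0 : ℝ), Function.Injective fun x => x - θ • G x := by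
  have hsmall : ∀ᶠ θ : ℝ in 𝓝 0, |θ| * L < 1 :=
    (continuous_abs.mul continuous_const).continuousAt.eventually_lt_const (by simp)
  filter_upwards [hsmall] with θ hθ x y hxy
  have hsub : x - y = θ • (G x - G y) := by
    rw [smul_sub, sub_eq_sub_iff_sub_eq_sub]
    exact hxy
  have hle : ‖x - y‖ ≤ |θ| * L * ‖x - y‖ := by
    calc ‖x - y‖ = |θ| * ‖G x - G y‖ := by rw [hsub, norm_smul, Real.norm_eq_abs]
      _ ≤ |θ| * (L * ‖x - y‖) := by gcongr; exact hG.norm_sub_le x y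
      _ = |θ| * L * ‖x - y‖ := (mul_assoc _ _ _).symm
  exact sub_eq_zero.1 (norm_eq_zero.1 (by nlinarith [norm_nonneg (x - y)]))

theorem eventually_forall_id_sub_smul_fderiv (hG : LipschitzWith L G) {P : (V →L[ℝ] V) → Prop}
    (hP : ∀ᶠ A in 𝓝 1, P A) :
    ∀ᶠ θ in 𝓝 (0 : ℝ), ∀ x, P (1 - θ • fderiv ℝ G x) := by
  obtain ⟨ρ, hρ, hball⟩ := Metric.eventually_nhds_iff.1 hP
  have hsmall : ∀ᶠ θ : ℝ in 𝓝 0, |θ| * L < ρ :=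
    (continuous_abs.mul continuous_const).continuousAt.eventually_lt_const (by simpa using hρ)
  filter_upwards [hsmall] with θ hθ x
  refine hball (lt_of_le_of_lt ?_ hθ)
  rw [dist_eq_norm, sub_sub_cancel_left, norm_neg, norm_smul, Real.norm_eq_abs]
  exact mul_le_mul_of_nonneg_left (norm_fderiv_le_of_lipschitz ℝ hG) (abs_nonneg θ)

theorem eventually_energy_comp_sub_smul_le (hp : 0 ≤ p) (hb : 1 < b) (hb_top : b ≠ ⊤)
    {G : EuclideanSpace ℝ (Fin N) → EuclideanSpace ℝ (Fin N)} (hG : Differentiable ℝ G)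
    (hGL : LipschitzWith L G) :
    ∀ᶠ θ in 𝓝 (0 : ℝ), ∀ φ : EuclideanSpace ℝ (Fin N) → ℝ, Differentiable ℝ φ →
      energy p (fun x => φ (x - θ • G x)) ≤ b ^ (p + 1) * energy p φ := by
  filter_upwards [eventually_injective_sub_smul hGL, eventually_forall_id_sub_smul_fderiv hGL
    (eventually_enorm_le_and_one_le_mul_det hb hb_top)] with θ hinj hA φ hφ
  exact energy_comp_le_of_injective hp hb_top
    (fun x => (hasFDerivAt_id x).sub ((hG x).hasFDerivAt.const_smul θ)) hinj
    (fun x => (hA x).1) (fun x => (hA x).2) hφ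

end Deformation

theorem IsTest.comp_of_eqOn_compl (hφ : IsTest E φ) (hE : Bornology.IsBounded E)
    {F : EuclideanSpace ℝ (Fin N) → EuclideanSpace ℝ (Fin N)} (hF : ContDiff ℝ ∞ F)
    (hFE : EqOn F id Eᶜ) : IsTest E (fun x => φ (F x)) := by
  have hsupp : tsupport (fun x => φ (F x)) ⊆ E := fun x hx => by
    have hFx : F x ∈ E := hφ.2.2 (tsupport_comp_subset_preimage φ hF.continuous hx)
    by_contra hxE
    exact hxE (by rwa [hFE hxE] at hFx)
  exact ⟨hφ.1.comp hF, HasCompactSupport.of_support_subset_isCompact hE.isCompact_closure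
    ((subset_tsupport _).trans (hsupp.trans subset_closure)), hsupp⟩

theorem eventually_relCap_closedBall_le (hp : 0 < p) (hb : 1 < b) (hb_top : b ≠ ⊤)
    (y : EuclideanSpace ℝ (Fin N)) {r R : ℝ} (hr : 0 < r) (hR : r < R) :
    ∀ᶠ θ in 𝓝 (0 : ℝ), relCap p (closedBall y r) (ball y R) ≤
      b ^ (p + 1) * relCap p (closedBall y ((1 - θ) * r)) (ball y R) := by
  let χ : ContDiffBump y := ⟨r, R, hr, hR⟩
  have hG : ContDiff ℝ ∞ fun x => χ x • (x - y) := χ.contDiff.smul (contDiff_id.sub contDiff_const)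
  obtain ⟨L, hL⟩ := hG.lipschitzWith_of_hasCompactSupport χ.hasCompactSupport.smul_right (by simp)
  have hb0 : b ^ (p + 1) ≠ 0 := (ENNReal.rpow_pos (one_pos.trans hb) hb_top).ne'
  have hbtop' : b ^ (p + 1) ≠ ⊤ := ENNReal.rpow_ne_top_of_nonneg (by linarith) hb_top
  filter_upwards [eventually_energy_comp_sub_smul_le hp.le hb hb_top
    (hG.differentiable (by simp)) hL, eventually_lt_nhds one_pos] with θ henergy hθ
  rw [← ENNReal.inv_mul_le_iff hb0 hbtop']
  refine le_relCap hp fun φ hφ hφ1 => ?_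
  rw [ENNReal.inv_mul_le_iff hb0 hbtop']
  have hφF : IsTest (ball y R) fun x => φ (x - θ • χ x • (x - y)) := by
    refine hφ.comp_of_eqOn_compl isBounded_ball (contDiff_id.sub (hG.const_smul θ))
      fun x hx => ?_
    rw [χ.zero_of_le_dist (not_lt.1 hx), zero_smul, smul_zero, sub_zero, id]
  refine (relCap_le hp hφF fun x hx => hφ1 _ ?_).trans (henergy φ hφ.differentiable)
  rw [χ.one_of_mem_closedBall hx, one_smul, mem_closedBall_iff_norm,
    show x - θ • (x - y) - y = (1 - θ) • (x - y) by module, norm_smul,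
    Real.norm_of_nonneg (by linarith)]
  exact mul_le_mul_of_nonneg_left (mem_closedBall_iff_norm.1 hx) (by linarith)

theorem exists_lt_relCap_closedBall (hp : 0 < p) {a : ℝ≥0∞} (y : EuclideanSpace ℝ (Fin N))
    {r R : ℝ} (hr : 0 < r) (hR : r < R) (ha : a < relCap p (closedBall y r) (ball y R)) :
    ∃ s, 0 < s ∧ s < r ∧ a < relCap p (closedBall y s) (ball y R) := by
  obtain ⟨ε, hε, hεa⟩ := exists_pos_ofReal_rpow_mul_lt ha (p + 1)
  have hle := eventually_relCap_closedBall_le hp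
    (ENNReal.one_lt_ofReal.2 (lt_add_of_pos_right 1 hε)) ENNReal.ofReal_ne_top y hr hR
  obtain ⟨θ, ⟨hθ, hθ1⟩, hθ0⟩ := ((hle.and (eventually_lt_nhds one_pos)).filter_mono
    (nhdsWithin_le_nhds (s := Ioi 0))).and self_mem_nhdsWithin |>.exists
  exact ⟨(1 - θ) * r, mul_pos (sub_pos.2 hθ1) hr, mul_lt_of_lt_one_left hr (sub_lt_self 1 hθ0),
    lt_of_mul_lt_mul_left' (hεa.trans_le hθ)⟩

/-! ### Test functions from competitors for the capacity -/

namespace IsCutoff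

variable {y : EuclideanSpace ℝ (Fin N)} {r R : ℝ} {L : NNReal}
  {η u : EuclideanSpace ℝ (Fin N) → ℝ}

theorem enorm_fderiv_add_mul_one_sub_le (hη : IsCutoff y r R L η) (hu : Differentiable ℝ u)
    (x : EuclideanSpace ℝ (Fin N)) :
    ‖fderiv ℝ (fun x => u x + η x * (1 - u x)) x‖ₑ ≤
      ‖fderiv ℝ u x‖ₑ + (ball y R).indicator (fun x => L * ‖1 - u x‖ₑ) x := by
  have hderiv : fderiv ℝ (fun x => u x + η x * (1 - u x)) x =
      (1 - η x) • fderiv ℝ u x + (1 - u x) • fderiv ℝ η x := by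
    rw [fderiv_fun_add (hu x) ((hη.isTest.differentiable x).fun_mul ((hu x).const_sub 1)),
      fderiv_fun_mul (hη.isTest.differentiable x) ((hu x).const_sub 1), fderiv_const_sub]
    module
  have hη1 : ‖1 - η x‖ₑ ≤ 1 := by
    simpa [Real.enorm_eq_ofReal (sub_nonneg.2 (hη.le_one x))] using hη.nonneg x
  rw [hderiv]
  refine (enorm_add_le ((1 - η x) • fderiv ℝ u x) ((1 - u x) • fderiv ℝ η x)).trans
    (add_le_add ?_ ?_)
  · rw [enorm_smul]
    exact mul_le_of_le_one_left' hη1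
  · by_cases hx : x ∈ ball y R
    · rw [indicator_of_mem hx, enorm_smul, mul_comm]
      exact mul_le_mul_left (hη.enorm_fderiv_le x) _
    · have h0 : fderiv ℝ η x = 0 :=
        by_contra fun h0 => hx (hη.isTest.2.2 (support_fderiv_subset ℝ h0))
      simp [h0, ← ofReal_norm]

theorem relCap_rpow_le (hp : 1 ≤ p) (hη : IsCutoff y r R L η) (hE : ball y R ⊆ E)
    (hu : IsTest E u) :
    relCap p (closedBall y r) E ^ (1 / p) ≤
      energy p u ^ (1 / p) + L * (∫⁻ x in ball y R, ‖1 - u x‖ₑ ^ p) ^ (1 / p) := by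
  have hp0 : 0 < p := by linarith
  have hLp : (L : ℝ≥0∞) ^ p ≠ ⊤ := ENNReal.rpow_ne_top_of_nonneg hp0.le ENNReal.coe_ne_top
  have hmeas : Measurable fun x => L * ‖1 - u x‖ₑ :=
    (continuous_const.sub hu.1.continuous).enorm.measurable.const_mul _
  have hmeas' : Measurable fun x => ‖fderiv ℝ u x‖ₑ :=
    (hu.contDiff_one.continuous_fderiv one_ne_zero).enorm.measurable
  have hind : ∫⁻ x, (ball y R).indicator (fun x => L * ‖1 - u x‖ₑ) x ^ p =
      L ^ p * ∫⁻ x in ball y R, ‖1 - u x‖ₑ ^ p := by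
    rw [← lintegral_const_mul' _ _ hLp, ← lintegral_indicator measurableSet_ball]
    refine lintegral_congr fun x => ?_
    by_cases hx : x ∈ ball y R <;> simp [hx, hp0, ENNReal.mul_rpow_of_nonneg _ _ hp0.le]
  have htest : IsTest E fun x => u x + η x * (1 - u x) :=
    hu.add ((hη.isTest.mono hE).mul_contDiff (contDiff_const.sub hu.1))
  calc relCap p (closedBall y r) E ^ (1 / p)
    _ ≤ energy p (fun x => u x + η x * (1 - u x)) ^ (1 / p) :=
      ENNReal.rpow_le_rpow (relCap_le hp0 htest fun x hx => by simp [hη.eq_one x hx])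
        (by positivity)
    _ ≤ (∫⁻ x, (‖fderiv ℝ u x‖ₑ +
        (ball y R).indicator (fun x => L * ‖1 - u x‖ₑ) x) ^ p) ^ (1 / p) :=
      ENNReal.rpow_le_rpow (lintegral_mono fun x => ENNReal.rpow_le_rpow
        (hη.enorm_fderiv_add_mul_one_sub_le hu.differentiable x) hp0.le) (by positivity)
    _ ≤ energy p u ^ (1 / p) +
        (∫⁻ x, (ball y R).indicator (fun x => L * ‖1 - u x‖ₑ) x ^ p) ^ (1 / p) :=
      ENNReal.lintegral_Lp_add_le hmeas'.aemeasurable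
        (hmeas.indicator measurableSet_ball).aemeasurable hp
    _ = _ := by
      rw [hind, ENNReal.mul_rpow_of_nonneg _ _ (by positivity), ← ENNReal.rpow_mul,
        mul_one_div_cancel hp0.ne', ENNReal.rpow_one]

theorem isTest_mul_one_sub (hη : IsCutoff y r R L η) (hu : ContDiff ℝ ∞ u)
    (hnear : ∀ x ∈ ball y R \ Ω, u =ᶠ[𝓝 x] 1) : IsTest Ω fun x => η x * (1 - u x) := by
  have h := hη.isTest.mul_contDiff (contDiff_const.sub hu : ContDiff ℝ ∞ fun x => 1 - u x)
  refine ⟨h.1, h.2.1, fun x hx => by_contra fun hxΩ => ?_⟩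
  refine notMem_tsupport_iff_eventuallyEq.2 ?_ hx
  filter_upwards [hnear x ⟨h.2.2 hx, hxΩ⟩] with z hz
  simp [hz]

theorem poincareConst_mul_setLIntegral_le (hp : 1 ≤ p) (hη : IsCutoff y r R L η)
    (hu : ContDiff ℝ ∞ u) (hu0 : ∀ x, 0 ≤ u x) (hu1 : ∀ x, u x ≤ 1)
    (hnear : ∀ x ∈ ball y R \ Ω, u =ᶠ[𝓝 x] 1) :
    poincareConst p Ω * ∫⁻ x in ball y r, ‖1 - u x‖ₑ ^ p ≤
      2 ^ (p - 1) * (L ^ p * volume (ball y R) + energy p u) := by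
  have hp0 : 0 < p := by linarith
  have hf : ContDiff ℝ ∞ fun x => 1 - u x := contDiff_const.sub hu
  have hle (x : EuclideanSpace ℝ (Fin N)) : ‖1 - u x‖ₑ ≤ 1 := by
    simpa [Real.enorm_eq_ofReal (sub_nonneg.2 (hu1 x))] using hu0 x
  calc poincareConst p Ω * ∫⁻ x in ball y r, ‖1 - u x‖ₑ ^ p
    _ = poincareConst p Ω * ∫⁻ x in ball y r, ‖η x * (1 - u x)‖ₑ ^ p := by
      rw [setLIntegral_congr_fun measurableSet_ball fun x hx => ?_]
      rw [hη.eq_one x (ball_subset_closedBall hx), one_mul]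
    _ ≤ poincareConst p Ω * ∫⁻ x, ‖η x * (1 - u x)‖ₑ ^ p :=
      mul_le_mul_right (setLIntegral_le_lintegral _ _) _
    _ ≤ energy p (fun x => η x * (1 - u x)) :=
      poincareConst_mul_le hp0 (hη.isTest_mul_one_sub hu hnear)
    _ ≤ 2 ^ (p - 1) * (L ^ p * (∫⁻ x in ball y R, ‖1 - u x‖ₑ ^ p) +
        ∫⁻ x in ball y R, ‖fderiv ℝ (fun x => 1 - u x) x‖ₑ ^ p) := hη.energy_mul_le hp hf
    _ ≤ 2 ^ (p - 1) * (L ^ p * volume (ball y R) + energy p u) := by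
      simp_rw [fderiv_const_sub, enorm_neg]
      refine mul_le_mul_right (add_le_add (mul_le_mul_right ?_ _)
        (setLIntegral_le_lintegral _ _)) _
      exact (lintegral_mono fun x => ENNReal.rpow_le_one (hle x) hp0.le).trans_eq
        (setLIntegral_one _)

end IsCutoff

theorem exists_poincareConst_le_of_relCap_lt (hp : 1 ≤ p) (y : EuclideanSpace ℝ (Fin N))
    {s r R : ℝ} (hs : 0 < s) (hsr : s < r) (hrR : r ≤ R) {a : ℝ≥0∞}
    (ha : a < relCap p (closedBall y s) (ball y R)) :
    ∃ C : ℝ≥0∞, C ≠ ⊤ ∧ ∀ Ω, relCap p (closedBall y r \ Ω) (ball y R) < a →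
      poincareConst p Ω ≤ C := by
  have hp0 : 0 < p := by linarith
  obtain ⟨t, hst, htr⟩ := exists_between hsr
  obtain ⟨L, hL⟩ := exists_isCutoff N hs hst
  obtain ⟨η, hη⟩ := hL y
  obtain ⟨L', hL'⟩ := exists_isCutoff N (hs.trans hst) htr
  obtain ⟨η', hη'⟩ := hL' y
  have ha_top : a ≠ ⊤ := ha.ne_top
  have hV : volume (ball y r) ≠ ⊤ := measure_ball_lt_top.ne
  set D : ℝ≥0∞ := 2 ^ (p - 1) * (L' ^ p * volume (ball y r) + a)
  set d := relCap p (closedBall y s) (ball y R) ^ (1 / p) - a ^ (1 / p) with hd_def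
  have hd : d ≠ 0 := (tsub_pos_of_lt (ENNReal.rpow_lt_rpow ha (by positivity))).ne'
  have hd_top : d ≠ ⊤ := ENNReal.sub_ne_top (ENNReal.rpow_ne_top_of_nonneg (by positivity)
    (relCap_closedBall_lt_top hp0 hs (hsr.trans_le hrR) y).ne)
  have hdp : d ^ p ≠ 0 := by simp [hd, hd_top]
  refine ⟨L ^ p * D / d ^ p, ENNReal.div_ne_top (by finiteness) hdp, fun Ω hΩ => ?_⟩
  obtain ⟨u, hu, hu0, hu1, hnear, hua⟩ := exists_normalized_of_relCap_lt hp0 hΩ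
  set J := ∫⁻ x in ball y t, ‖1 - u x‖ₑ ^ p
  have hJ : d ^ p ≤ L ^ p * J := by
    have hdJ : d ≤ L * J ^ (1 / p) := by
      rw [hd_def, tsub_le_iff_left]
      exact (hη.relCap_rpow_le hp (ball_subset_ball (htr.le.trans hrR)) hu).trans
        (add_le_add (ENNReal.rpow_le_rpow hua.le (by positivity)) le_rfl)
    calc d ^ p ≤ (L * J ^ (1 / p)) ^ p := ENNReal.rpow_le_rpow hdJ hp0.le
      _ = L ^ p * J := by
        rw [ENNReal.mul_rpow_of_nonneg _ _ hp0.le, one_div, ENNReal.rpow_inv_rpow hp0.ne']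
  have hJD : poincareConst p Ω * J ≤ D :=
    (hη'.poincareConst_mul_setLIntegral_le hp hu.1 hu0 hu1 fun x hx =>
      hnear x ⟨ball_subset_closedBall hx.1, hx.2⟩).trans
      (mul_le_mul_right (add_le_add le_rfl hua.le) _)
  rw [ENNReal.le_div_iff_mul_le (Or.inl hdp) (Or.inl (by finiteness))]
  calc poincareConst p Ω * d ^ p
    _ ≤ poincareConst p Ω * (L ^ p * J) := mul_le_mul_right hJ _
    _ = L ^ p * (poincareConst p Ω * J) := mul_left_comm _ _ _
    _ ≤ L ^ p * D := mul_le_mul_right hJD _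

theorem exists_poincareConst_le_of_isNegligible (N : ℕ) [NeZero N] (hp : 1 ≤ p) {γ : ℝ}
    (hγ : γ < 1) :
    ∃ C : ℝ≥0∞, C ≠ ⊤ ∧ ∀ Ω : Set (EuclideanSpace ℝ (Fin N)),
      IsNegligible p γ 0 1 (closedBall 0 1 \ Ω) → poincareConst p Ω ≤ C := by
  have hp0 : 0 < p := by linarith
  simp_rw [IsNegligible, mul_one]
  set c := relCap p (closedBall (0 : EuclideanSpace ℝ (Fin N)) 1) (ball 0 2)
  have hc0 : c ≠ 0 := relCap_closedBall_ne_zero hp one_pos 0 2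
  have hc_top : c ≠ ⊤ := (relCap_closedBall_lt_top hp0 one_pos one_lt_two 0).ne
  have hγc : ENNReal.ofReal γ * c < c := by
    simpa using ENNReal.mul_lt_mul_left hc0 hc_top (ENNReal.ofReal_lt_one.2 hγ)
  obtain ⟨s, hs, hs1, hγs⟩ := exists_lt_relCap_closedBall hp0 0 one_pos one_lt_two hγc
  obtain ⟨a, hγa, has⟩ := exists_between hγs
  obtain ⟨C, hC_top, hC⟩ := exists_poincareConst_le_of_relCap_lt hp 0 hs hs1 one_le_two has
  exact ⟨C, hC_top, fun Ω hΩ => hC Ω (hΩ.trans_lt hγa)⟩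

theorem poincareConst_le_mul_inv_capInradius_rpow (hp : 0 < p) {γ : ℝ} {C : ℝ≥0∞} (hC : C ≠ 0)
    (hC_top : C ≠ ⊤) (h : ∀ Ω : Set (EuclideanSpace ℝ (Fin N)),
      IsNegligible p γ 0 1 (closedBall 0 1 \ Ω) → poincareConst p Ω ≤ C)
    (Ω : Set (EuclideanSpace ℝ (Fin N))) :
    poincareConst p Ω ≤ C * (capInradius p γ Ω)⁻¹ ^ p := by
  rw [ENNReal.inv_rpow, ← div_eq_mul_inv,
    ENNReal.le_div_iff_mul_le (Or.inr hC) (Or.inr hC_top), mul_comm,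
    ← ENNReal.le_div_iff_mul_le (Or.inr hC) (Or.inr hC_top), ← ENNReal.le_rpow_inv_iff hp]
  refine iSup₂_le fun r ⟨hr, a, ha⟩ => ?_
  rw [ENNReal.le_rpow_inv_iff hp, ENNReal.le_div_iff_mul_le (Or.inr hC) (Or.inr hC_top),
    ← poincareConst_preimage_add_smul a hr hp]
  exact h _ ((isNegligible_closedBall_diff_preimage_add_smul a hr hp γ 0 1 Ω).2 (by simpa using ha))

theorem exists_poincareConst_le_mul_inv_capInradius_rpow (N : ℕ) [NeZero N] (hp : 1 ≤ p) {γ : ℝ}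
    (hγ : γ < 1) :
    ∃ C : ℝ, ∀ Ω : Set (EuclideanSpace ℝ (Fin N)),
      poincareConst p Ω ≤ ENNReal.ofReal C * (capInradius p γ Ω)⁻¹ ^ p := by
  obtain ⟨C, hC_top, hC⟩ := exists_poincareConst_le_of_isNegligible N hp hγ
  refine ⟨C.toReal + 1, poincareConst_le_mul_inv_capInradius_rpow (by linarith)
    (ENNReal.ofReal_pos.2 (by positivity)).ne' ENNReal.ofReal_ne_top fun Ω hΩ => (hC Ω hΩ).trans ?_⟩
  rw [ENNReal.le_ofReal_iff_toReal_le hC_top (by positivity)]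
  linarith

/-! ### Strict monotonicity of the capacity -/

theorem energy_add_le_of_forall_fderiv_eq_zero (p : ℝ) (hφ : ContDiff ℝ 1 φ)
    (hψ : Differentiable ℝ ψ) (h : ∀ x, fderiv ℝ φ x = 0 ∨ fderiv ℝ ψ x = 0) :
    energy p (fun x => φ x + ψ x) ≤ energy p φ + energy p ψ := by
  have hmeas : Measurable fun x => ‖fderiv ℝ φ x‖ₑ ^ p :=
    (hφ.continuous_fderiv one_ne_zero).enorm.measurable.pow_const p
  unfold energy
  rw [← lintegral_add_left hmeas]
  refine lintegral_mono fun x => ?_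
  rw [fderiv_fun_add (hφ.differentiable one_ne_zero x) (hψ x)]
  rcases h x with h0 | h0
  · rw [h0, zero_add]
    exact le_add_self
  · rw [h0, add_zero]
    exact le_self_add

theorem relCap_le_energy_add_energy (hp : 0 < p) (hKK' : K ⊆ K') (hE'K' : E' ⊆ K') (hE' : E' ⊆ E)
    (hφ : IsTest E φ) (hφK' : ∀ x ∈ K', φ =ᶠ[𝓝 x] 1) (hψ : IsTest E' ψ) (hψK : ∀ x ∈ K, 1 ≤ ψ x)
    {s : ℝ} (hs : 0 ≤ s) :
    relCap p K E ≤ ‖1 - s‖ₑ ^ p * energy p φ + ‖s‖ₑ ^ p * energy p ψ := by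
  have hdisj (x : EuclideanSpace ℝ (Fin N)) :
      fderiv ℝ (fun x => (1 - s) * φ x) x = 0 ∨ fderiv ℝ (fun x => s * ψ x) x = 0 := by
    rw [fderiv_const_mul (hφ.differentiable x), fderiv_const_mul (hψ.differentiable x)]
    by_cases hx : x ∈ K'
    · left
      rw [(hφK' x hx).fderiv_eq, fderiv_one, Pi.zero_apply, smul_zero]
    · right
      have h0 : fderiv ℝ ψ x = 0 :=
        by_contra fun h0 => hx (hE'K' (hψ.2.2 (support_fderiv_subset ℝ h0)))
      rw [h0, smul_zero]
  calc relCap p K E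
    _ ≤ energy p (fun x => (1 - s) * φ x + s * ψ x) := by
      refine relCap_le hp ((hφ.const_mul _).add ((hψ.mono hE').const_mul s)) fun x hx => ?_
      rw [(hφK' x (hKK' hx)).eq_of_nhds, Pi.one_apply]
      nlinarith [hψK x hx]
    _ ≤ energy p (fun x => (1 - s) * φ x) + energy p (fun x => s * ψ x) :=
      energy_add_le_of_forall_fderiv_eq_zero p (hφ.const_mul _).contDiff_one
        (hψ.differentiable.const_mul s) hdisj
    _ = _ := by
      rw [energy_const_mul hp.le hφ.differentiable, energy_const_mul hp.le hψ.differentiable]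

theorem relCap_le_rpow_mul_add_rpow_mul (hp : 0 < p) (hKK' : K ⊆ K') (hE'K' : E' ⊆ K')
    (hE' : E' ⊆ E) {s : ℝ} (hs : 0 < s) (hs1 : s < 1) :
    relCap p K E ≤
      ENNReal.ofReal (1 - s) ^ p * relCap p K' E + ENNReal.ofReal s ^ p * relCap p K E' := by
  have hs1' : 0 < 1 - s := sub_pos.2 hs1
  rw [← tsub_le_iff_right,
    ← ENNReal.inv_mul_le_iff (ofReal_rpow_ne_zero hs1' p) (ofReal_rpow_ne_top hs1' p)]
  refine le_of_forall_gt_imp_ge_of_dense fun b hb => ?_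
  obtain ⟨φ, hφ, -, -, hφK', hφb⟩ := exists_normalized_of_relCap_lt hp hb
  refine le_trans ?_ hφb.le
  rw [ENNReal.inv_mul_le_iff (ofReal_rpow_ne_zero hs1' p) (ofReal_rpow_ne_top hs1' p),
    tsub_le_iff_right, ← tsub_le_iff_left,
    ← ENNReal.inv_mul_le_iff (ofReal_rpow_ne_zero hs p) (ofReal_rpow_ne_top hs p)]
  refine le_relCap hp fun ψ hψ hψK => ?_
  rw [ENNReal.inv_mul_le_iff (ofReal_rpow_ne_zero hs p) (ofReal_rpow_ne_top hs p),
    tsub_le_iff_left, ← Real.enorm_eq_ofReal hs1'.le, ← Real.enorm_eq_ofReal hs.le]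
  exact relCap_le_energy_add_energy hp hKK' hE'K' hE' hφ hφK' hψ hψK hs.le

/-- Layering a competitor for `relCap p K E'` on top of one for `relCap p K' E` costs `s ^ p`
instead of `s`, which for `1 < p` is negligible as `s → 0`. -/
theorem relCap_lt_relCap (hp : 1 < p) (hKK' : K ⊆ K') (hE'K' : E' ⊆ K') (hE' : E' ⊆ E)
    (h0 : relCap p K' E ≠ 0) (htop : relCap p K' E ≠ ⊤) (hKE' : relCap p K E' ≠ ⊤) :
    relCap p K E < relCap p K' E := by
  have hp0 : 0 < p := by linarith
  set c := relCap p K' E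
  set d := relCap p K E'
  obtain ⟨s, hs, hs1, hsd⟩ : ∃ s : ℝ, 0 < s ∧ s < 1 ∧ ENNReal.ofReal s ^ (p - 1) * d < c := by
    have hlim : Tendsto (fun s : ℝ => ENNReal.ofReal s ^ (p - 1) * d) (𝓝 0) (𝓝 0) := by
      have hcont : Continuous fun s : ℝ => ENNReal.ofReal s ^ (p - 1) * d :=
        (ENNReal.continuous_mul_const hKE').comp
          (ENNReal.continuous_rpow_const.comp ENNReal.continuous_ofReal)
      simpa [hp] using hcont.tendsto 0
    obtain ⟨s, ⟨hsd, hs1⟩, hs⟩ := (((hlim.eventually_lt_const (pos_iff_ne_zero.2 h0)).and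
      (eventually_lt_nhds one_pos)).filter_mono (nhdsWithin_le_nhds (s := Ioi 0))).and
      self_mem_nhdsWithin |>.exists
    exact ⟨s, hs, hs1, hsd⟩
  have hs1' : 0 < 1 - s := sub_pos.2 hs1
  have hsp : ENNReal.ofReal s ^ p = ENNReal.ofReal s * ENNReal.ofReal s ^ (p - 1) := by
    simpa using ENNReal.rpow_add 1 (p - 1) (ENNReal.ofReal_pos.2 hs).ne' ENNReal.ofReal_ne_top
  calc relCap p K E
    _ ≤ ENNReal.ofReal (1 - s) ^ p * c + ENNReal.ofReal s ^ p * d :=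
      relCap_le_rpow_mul_add_rpow_mul hp0 hKK' hE'K' hE' hs hs1
    _ ≤ ENNReal.ofReal (1 - s) * c + ENNReal.ofReal s * (ENNReal.ofReal s ^ (p - 1) * d) := by
      refine add_le_add (mul_le_mul_left ?_ _) (le_of_eq ?_)
      · exact ENNReal.rpow_le_self_of_le_one (ENNReal.ofReal_le_one.2 (by linarith)) hp.le
      · rw [← mul_assoc, hsp]
    _ < ENNReal.ofReal (1 - s) * c + ENNReal.ofReal s * c :=
      ENNReal.add_lt_add_left (by finiteness)
        (ENNReal.mul_lt_mul_right (ENNReal.ofReal_pos.2 hs).ne' ENNReal.ofReal_ne_top hsd)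
    _ = c := by
      rw [← add_mul, ← ENNReal.ofReal_add hs1'.le hs.le, sub_add_cancel, ENNReal.ofReal_one,
        one_mul]

theorem relCap_closedBall_lt_of_lt_natCast [NeZero N] (hp : 1 ≤ p) (hpN : p < N)
    (y : EuclideanSpace ℝ (Fin N)) {s r R : ℝ} (hs : 0 < s) (hsr : s < r) (hrR : r < R) :
    relCap p (closedBall y s) (ball y R) < relCap p (closedBall y r) (ball y R) := by
  have hp0 : 0 < p := by linarith
  have hr : 0 < r := hs.trans hsr
  set t := s / r
  have ht : 0 < t := div_pos hs hr
  have ht1 : t < 1 := (div_lt_one hr).2 hsr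
  have hscale : relCap p (closedBall y r) (ball y R) =
      ENNReal.ofReal t ^ (p - N) * relCap p (closedBall y s) (ball y (t * R)) := by
    have h := relCap_closedBall_ball_eq_rpow_mul ((1 - t) • y) ht hp0 y r R
    rwa [← add_smul, sub_add_cancel, one_smul, div_mul_cancel₀ s hr.ne'] at h
  have hfactor : 1 < ENNReal.ofReal t ^ (p - N) :=
    ENNReal.one_lt_rpow_of_pos_of_lt_one_of_neg (ENNReal.ofReal_pos.2 ht)
      (ENNReal.ofReal_lt_one.2 ht1) (sub_neg.2 hpN)
  have htR : t * R ≤ R := mul_le_of_le_one_left (hr.trans hrR).le ht1.le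
  calc relCap p (closedBall y s) (ball y R)
    _ = 1 * relCap p (closedBall y s) (ball y R) := (one_mul _).symm
    _ < ENNReal.ofReal t ^ (p - N) * relCap p (closedBall y s) (ball y R) :=
      ENNReal.mul_lt_mul_left (relCap_closedBall_ne_zero hp hs y R)
        (relCap_closedBall_lt_top hp0 hs (hsr.trans hrR) y).ne hfactor
    _ ≤ ENNReal.ofReal t ^ (p - N) * relCap p (closedBall y s) (ball y (t * R)) :=
      mul_le_mul_right (relCap_mono hp0 subset_rfl (ball_subset_ball htR)) _
    _ = relCap p (closedBall y r) (ball y R) := hscale.symm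

theorem relCap_closedBall_lt_of_lt [NeZero N] (hp : 1 ≤ p) (hpN : 1 < p ∨ p < N)
    (y : EuclideanSpace ℝ (Fin N)) {s r R : ℝ} (hs : 0 < s) (hsr : s < r) (hrR : r < R) :
    relCap p (closedBall y s) (ball y R) < relCap p (closedBall y r) (ball y R) := by
  rcases hpN with hp1 | hpN
  · exact relCap_lt_relCap hp1 (closedBall_subset_closedBall hsr.le) ball_subset_closedBall
      (ball_subset_ball hrR.le) (relCap_closedBall_ne_zero hp (hs.trans hsr) y R)
      (relCap_closedBall_lt_top (by linarith) (hs.trans hsr) hrR y).ne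
      (relCap_closedBall_lt_top (by linarith) hs hsr y).ne
  · exact relCap_closedBall_lt_of_lt_natCast hp hpN y hs hsr hrR

theorem exists_isOpen_superset_lt_poincareConst [NeZero N] (hp : 1 ≤ p)
    {S : Set (EuclideanSpace ℝ (Fin N))} (hS : volume S = 0) {M : ℝ≥0∞} (hM : M ≠ ⊤) :
    ∃ Ω, IsOpen Ω ∧ S ⊆ Ω ∧ M < poincareConst p Ω := by
  have hp0 : 0 < p := by linarith
  obtain ⟨s, hs, hsM⟩ : ∃ s : ℝ, 0 < s ∧
      2 * (ENNReal.ofReal (2 * s) ^ p * 2 ^ N) < M⁻¹ := by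
    have hlim : Tendsto (fun s : ℝ => 2 * (ENNReal.ofReal (2 * s) ^ p * 2 ^ N)) (𝓝 0) (𝓝 0) := by
      have hcont : Continuous fun s : ℝ => 2 * (ENNReal.ofReal (2 * s) ^ p * 2 ^ N) :=
        (ENNReal.continuous_const_mul (by simp)).comp ((ENNReal.continuous_mul_const (by simp)).comp
          (ENNReal.continuous_rpow_const.comp (ENNReal.continuous_ofReal.comp (by fun_prop))))
      simpa [hp0] using hcont.tendsto 0
    obtain ⟨s, hsM, hs⟩ := (((hlim.eventually_lt_const
      (ENNReal.inv_pos.2 hM)).filter_mono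
        (nhdsWithin_le_nhds (s := Ioi 0))).and self_mem_nhdsWithin).exists
    exact ⟨s, hs, hsM⟩
  obtain ⟨Ω, hSΩ, hΩ, hvol⟩ := S.exists_isOpen_lt_of_lt (volume (ball 0 s) / 2) <| hS ▸
    ENNReal.div_pos (measure_ball_pos volume (0 : EuclideanSpace ℝ (Fin N)) hs).ne' (by simp)
  refine ⟨Ω, hΩ, hSΩ, (ENNReal.lt_inv_iff_lt_inv.1 hsM).trans_le
    (le_poincareConst_of_volume_le hp hs ?_)⟩
  rw [mul_comm, ← ENNReal.le_div_iff_mul_le (by simp) (by simp)]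
  exact hvol.le

theorem exists_isOpen_lt_poincareConst_relCap_lt (N : ℕ) [NeZero N] (hp : 1 ≤ p)
    (hpN : 1 < p ∨ p < N) {M : ℝ≥0∞} (hM : M ≠ ⊤) :
    ∃ Ω : Set (EuclideanSpace ℝ (Fin N)), IsOpen Ω ∧ M < poincareConst p Ω ∧
      relCap p (closedBall 0 1 \ Ω) (ball 0 2) <
        relCap p (closedBall (0 : EuclideanSpace ℝ (Fin N)) 1) (ball 0 2) := by
  obtain ⟨Ω, hΩ, hSΩ, hMΩ⟩ := exists_isOpen_superset_lt_poincareConst hp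
    (Measure.addHaar_sphere_of_ne_zero volume (0 : EuclideanSpace ℝ (Fin N)) one_ne_zero) hM
  have hball : closedBall 0 1 \ Ω ⊆ ball 0 1 := fun x hx =>
    (ball_union_sphere (x := (0 : EuclideanSpace ℝ (Fin N))) ▸ hx.1).resolve_right fun h =>
      hx.2 (hSΩ h)
  obtain ⟨s, hs1, hs⟩ := exists_lt_subset_ball (isClosed_closedBall.sdiff hΩ) hball
  obtain ⟨t, ht, ht1⟩ := exists_between (max_lt hs1 one_pos)
  refine ⟨Ω, hΩ, hMΩ, (relCap_mono (by linarith) (hs.trans fun x hx => ?_) subset_rfl).trans_lt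
    (relCap_closedBall_lt_of_lt hp hpN 0 ((le_max_right _ _).trans_lt ht) ht1 one_lt_two)⟩
  exact ball_subset_closedBall (ball_subset_ball ((le_max_left _ _).trans ht.le) hx)

theorem eventually_one_le_capInradius
    (h : relCap p (closedBall 0 1 \ Ω) (ball 0 2) <
      relCap p (closedBall (0 : EuclideanSpace ℝ (Fin N)) 1) (ball 0 2)) :
    ∀ᶠ γ in 𝓝[<] (1 : ℝ), 1 ≤ capInradius p γ Ω := by
  set c := relCap p (closedBall (0 : EuclideanSpace ℝ (Fin N)) 1) (ball 0 2)
  have hlim : Tendsto (fun γ : ℝ => ENNReal.ofReal γ * c) (𝓝[<] 1) (𝓝 (ENNReal.ofReal 1 * c)) :=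
    (ENNReal.Tendsto.mul_const (ENNReal.continuous_ofReal.tendsto 1)
      (Or.inl (by simp))).mono_left nhdsWithin_le_nhds
  rw [ENNReal.ofReal_one, one_mul] at hlim
  filter_upwards [hlim.eventually_const_lt h] with γ hγ
  rw [← ENNReal.ofReal_one]
  refine ofReal_le_capInradius one_pos (y := 0) ?_
  rw [IsNegligible, mul_one]
  exact hγ.le

theorem tendsto_atTop_of_forall_poincareConst_le [NeZero N] (hp : 1 ≤ p) (hpN : 1 < p ∨ p < N)
    {C : ℝ → ℝ}
    (hC : ∀ γ : ℝ, 0 < γ → γ < 1 → ∀ Ω : Set (EuclideanSpace ℝ (Fin N)), IsOpen Ω →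
      poincareConst p Ω ≤ ENNReal.ofReal (C γ) * (capInradius p γ Ω)⁻¹ ^ p) :
    Tendsto C (𝓝[<] 1) atTop := by
  rw [← ENNReal.tendsto_ofReal_nhds_top, ENNReal.tendsto_nhds_top_iff_nnreal]
  intro M
  obtain ⟨Ω, hΩ, hMΩ, hcap⟩ :=
    exists_isOpen_lt_poincareConst_relCap_lt N hp hpN (ENNReal.coe_ne_top (r := M))
  filter_upwards [eventually_one_le_capInradius hcap, Ioo_mem_nhdsLT one_pos] with γ hR hγ
  calc (M : ℝ≥0∞)
    _ < poincareConst p Ω := hMΩ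
    _ ≤ ENNReal.ofReal (C γ) * (capInradius p γ Ω)⁻¹ ^ p := hC γ hγ.1 hγ.2 Ω hΩ
    _ ≤ ENNReal.ofReal (C γ) :=
      mul_le_of_le_one_right' (ENNReal.rpow_le_one (ENNReal.inv_le_one.2 hR) (by linarith))

theorem poincareConst_pos_iff_capInradius_lt_top [NeZero N] (hp : 1 ≤ p) {γ : ℝ} (hγ : 0 < γ)
    (hγ1 : γ < 1) (Ω : Set (EuclideanSpace ℝ (Fin N))) :
    0 < poincareConst p Ω ↔ capInradius p γ Ω < ⊤ := by
  have hp0 : 0 < p := by linarith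
  refine ⟨fun h => lt_top_iff_ne_top.2 fun htop => h.not_ge ?_, fun h => ?_⟩
  · obtain ⟨C, hC⟩ := exists_poincareConst_le_mul_inv_capInradius_rpow N hp hγ1
    simpa [htop, hp0] using hC Ω
  · obtain ⟨σ, hσ, hlower⟩ := exists_mul_inv_capInradius_rpow_le_poincareConst N hp
    refine (ENNReal.mul_pos (ENNReal.ofReal_pos.2 (mul_pos hσ hγ)).ne' ?_).trans_le (hlower γ Ω)
    simp [h.ne, hp0.le]

end CapInradius

theorem mainTheorem1_general (N : ℕ) [NeZero N] (p : ℝ) (hp : 1 ≤ p) (hpN : 1 < p ∨ p < N) :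
    (∃ σ : ℝ, 0 < σ ∧ ∃ C : ℝ → ℝ,
      (∀ γ : ℝ, 0 < γ → γ < 1 → ∀ Ω : Set (EuclideanSpace ℝ (Fin N)),
        ENNReal.ofReal (σ * γ) * (CapInradius.capInradius p γ Ω)⁻¹ ^ p
            ≤ CapInradius.poincareConst p Ω ∧
        CapInradius.poincareConst p Ω
            ≤ ENNReal.ofReal (C γ) * (CapInradius.capInradius p γ Ω)⁻¹ ^ p) ∧
      Tendsto C (𝓝[<] 1) atTop) ∧
    (∀ C : ℝ → ℝ,
      (∀ γ : ℝ, 0 < γ → γ < 1 → ∀ Ω : Set (EuclideanSpace ℝ (Fin N)), IsOpen Ω →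
        CapInradius.poincareConst p Ω
            ≤ ENNReal.ofReal (C γ) * (CapInradius.capInradius p γ Ω)⁻¹ ^ p) →
      Tendsto C (𝓝[<] 1) atTop) ∧
    (∀ Ω : Set (EuclideanSpace ℝ (Fin N)),
      (∀ γ : ℝ, 0 < γ → γ < 1 →
        (0 < CapInradius.poincareConst p Ω ↔ CapInradius.capInradius p γ Ω < ⊤)) ∧
      (∀ γ γ' : ℝ, 0 < γ → γ < 1 → 0 < γ' → γ' < 1 →
        (CapInradius.capInradius p γ Ω < ⊤ ↔ CapInradius.capInradius p γ' Ω < ⊤))) := by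
  obtain ⟨σ, hσ, hlower⟩ :=
    CapInradius.exists_mul_inv_capInradius_rpow_le_poincareConst N hp
  choose! C hupper using fun (γ : ℝ) (hγ : γ < 1) =>
    CapInradius.exists_poincareConst_le_mul_inv_capInradius_rpow N hp hγ
  have hblowup (C : ℝ → ℝ) := CapInradius.tendsto_atTop_of_forall_poincareConst_le hp hpN (C := C)
  have hiff (γ : ℝ) (hγ : 0 < γ) (hγ1 : γ < 1) :=
    CapInradius.poincareConst_pos_iff_capInradius_lt_top (N := N) hp hγ hγ1
  exact ⟨⟨σ, hσ, C, fun γ _ hγ Ω => ⟨hlower γ Ω, hupper γ hγ Ω⟩,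
      hblowup C fun γ _ hγ Ω _ => hupper γ hγ Ω⟩,
    hblowup,
    fun Ω => ⟨fun γ hγ hγ1 => hiff γ hγ hγ1 Ω, fun γ γ' hγ hγ1 hγ' hγ1' =>
      (hiff γ hγ hγ1 Ω).symm.trans (hiff γ' hγ' hγ1' Ω)⟩⟩

theorem mainTheorem1 (N : ℕ) (hN : 2 ≤ N) (p : ℝ) (hp1 : 1 ≤ p) (hpN : p ≤ N) :
    -- the two-sided estimate
    (∃ σ : ℝ, 0 < σ ∧ ∃ C : ℝ → ℝ,
      (∀ γ : ℝ, 0 < γ → γ < 1 → ∀ Ω : Set (EuclideanSpace ℝ (Fin N)), IsOpen Ω →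
        ENNReal.ofReal (σ * γ) * (CapInradius.capInradius p γ Ω)⁻¹ ^ p
            ≤ CapInradius.poincareConst p Ω ∧
        CapInradius.poincareConst p Ω
            ≤ ENNReal.ofReal (C γ) * (CapInradius.capInradius p γ Ω)⁻¹ ^ p) ∧
      Tendsto C (𝓝[<] 1) atTop) ∧
    -- the blow-up of the upper constant is unavoidable
    (∀ C : ℝ → ℝ,
      (∀ γ : ℝ, 0 < γ → γ < 1 → ∀ Ω : Set (EuclideanSpace ℝ (Fin N)), IsOpen Ω →
        CapInradius.poincareConst p Ω
            ≤ ENNReal.ofReal (C γ) * (CapInradius.capInradius p γ Ω)⁻¹ ^ p) →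
      Tendsto C (𝓝[<] 1) atTop) ∧
    -- positivity of the Poincaré constant, and independence of `γ`
    (∀ Ω : Set (EuclideanSpace ℝ (Fin N)), IsOpen Ω →
      (∀ γ : ℝ, 0 < γ → γ < 1 →
        (0 < CapInradius.poincareConst p Ω ↔ CapInradius.capInradius p γ Ω < ⊤)) ∧
      (∀ γ γ' : ℝ, 0 < γ → γ < 1 → 0 < γ' → γ' < 1 →
        (CapInradius.capInradius p γ Ω < ⊤ ↔ CapInradius.capInradius p γ' Ω < ⊤))) := by
  have : NeZero N := ⟨by omega⟩
  obtain ⟨⟨σ, hσ, C, hC, hlim⟩, hblowup, hiff⟩ := mainTheorem1_general N p hp1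
    ((lt_or_ge 1 p).imp_right fun h => h.trans_lt (by exact_mod_cast hN))
  exact ⟨⟨σ, hσ, C, fun γ hγ hγ1 Ω _ => hC γ hγ hγ1 Ω, hlim⟩, hblowup, fun Ω _ => hiff Ω⟩
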